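/- Let $[z]=z-z^{-1}$, let $N\ge 0$ be an integer, let $q\in\mathbb C^\times$ with $q^4\neq 1$, and fix a square root $s=\sqrt{[q][q^2]}$. In the basis $|{\uparrow\Uparrow}\rangle,|{\uparrow 0}\rangle,|{\uparrow\Downarrow}\rangle,|{\downarrow\Uparrow}\rangle,|{\downarrow 0}\rangle,|{\downarrow\Downarrow}\rangle$ of $\mathbb C^2\otimes\mathbb C^3$ let $$R(z)=\begin{pmatrix}[q^2z]&0&0&0&0&0\\0&[qz]&0&s&0&0\\0&0&[z]&0&s&0\\0&s&0&[z]&0&0\\0&0&s&0&[qz]&0\\0&0&0&0&0&[q^2z]\end{pmatrix}.$$ For $w_1,\dots,w_N\in\mathbb C^\times$ define on $\mathbb C^2\otimes(\mathbb C^3)^{\otimes N}$ (with auxiliary space $a=\mathbb C^2$) the monodromy matrix of the ten-vertex model $$\mathcal T_a(z)=R_{a,N}(q^{-1}z/w_N)\cdots R_{a,1}(q^{-1}z/w_1)=\begin{pmatrix}\mathcal A(z)&\mathcal B(z)\\ \mathcal C(z)&\mathcal D(z)\end{pmatrix}_{a}$$ and the transfer matrix with anti-diagonal twist $$T^{(1)}(z)=\mathrm{tr}_a\Big(\begin{pmatrix}0&\mathrm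 i\\ \mathrm i&0\end{pmatrix}_{a}\mathcal T_a(z)\Big)=\mathrm i\big(\mathcal B(z)+\mathcal C(z)\big),\qquad z\in\mathbb C^\times .$$ Put $a(z)=\prod_{i=1}^N[qz/w_i]$, $d(z)=\prod_{i=1}^N[q^{-1}z/w_i]$ and $|\wedge\rangle=|{\Uparrow\cdots\Uparrow}\rangle$, with dual basis covector $\langle\wedge|$. For $\boldsymbol h=(h_1,\dots,h_N)\in\{0,1,2\}^N$ the separation-of-variables (height) states and their duals are $$\|\boldsymbol h\rangle\rangle=\prod_{j=1}^N\prod_{l=0}^{h_j-1}\frac{\mathcal B(q^{1-l}w_j)}{a(q^{1-l}w_j)}\,|\wedge\rangle,\qquad \langle\langle\boldsymbol h\|=\langle\wedge|\prod_{j=1}^N\prod_{l=0}^{h_j-1}\frac{\mathcal C(q^{1-l}w_j)}{d(q^{-l}w_j)} .$$ (The operators $\mathcal B$ commute among themselves, and so do the operators $\mathcal C$, so the order of the factors does not matter.) (1) Suppose that $w_i^2\ne q^{2m}w_j^2$ for all $i\neq j$ and all $m\in\{-2,-1,0,1,2\}$. Then the states $\|\boldsymbol h\rangle\rangle$ are a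 basis of $(\mathbb C^3)^{\otimes N}$ and the states $\langle\langle\boldsymbol h\|$ are a basis of its dual. The space of covectors $\langle\varphi|$ with $\langle\varphi|T^{(1)}(z)=0$ for all $z\in\mathbb C^\times$ and the space of vectors $|v\rangle$ with $T^{(1)}(z)|v\rangle=0$ for all $z\in\mathbb C^\times$ are both one-dimensional. They are spanned, respectively, by a covector $\langle\psi_{AD}|$ and a vector $|\psi_{AD}\rangle$ such that, for all $\boldsymbol h\in\{0,1,2\}^N$, $$\langle\psi_{AD}\|\boldsymbol h\rangle\rangle=\prod_{i,j=1}^N\frac{[q^{1-h_i}w_i/w_j]}{[qw_i/w_j]},\qquad \langle\langle\boldsymbol h\|\psi_{AD}\rangle=\prod_{i,j=1}^N\frac{[q^{2(h_i-1)}w_i/w_j]}{[q^{-2}w_i/w_j]} .$$ (2) For generic inhomogeneities, $0$ is a simple eigenvalue of the matrix $T^{(1)}(z)$ for generic $z$: there is a non-zero polynomial $P\in\mathbb C[x_1,\dots,x_N]$ such that, if in addition to the condition in (1) $P(w_1,\dots,w_N)\neq0$, then for all but finitely many $z\in\mathbb C^\times$ the eigenvalue $0$ of $T^{(1)}(z)$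 has algebraic multiplicity one. -/

import Mathlib

open scoped Matrix Kronecker

noncomputable section

namespace TenVertex

/-- The short-hand notation `[z] = z - z⁻¹`. -/
def br (z : ℂ) : ℂ := z - z⁻¹

/-- Configurations of `N` spins one: `0, 1, 2` stand for `⇑, 0, ⇓`.  They label the canonical
basis of `(ℂ³)^{⊗N}`, whose vectors and covectors are represented by their components
`Conf N → ℂ`; a covector `φ` is paired with a vector `v` bilinearly, by `φ ⬝ᵥ v`. -/
abbrev Conf (N : ℕ) : Type := Fin N → Fin 3

/-- The row and column labels of `R`, in the order `↑⇑, ↑0, ↑⇓, ↓⇑, ↓0, ↓⇓`. -/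
def pairIndex (p : Fin 2 × Fin 3) : Fin 6 := finProdFinEquiv p

/-- The `R`-matrix `R^{(1,2)}(z)` of the ten-vertex model on `ℂ² ⊗ ℂ³`; here `s` is the chosen
square root of `[q][q²]`. -/
def R12 (q s z : ℂ) : Matrix (Fin 2 × Fin 3) (Fin 2 × Fin 3) ℂ :=
  (!![br (q ^ 2 * z), 0, 0, 0, 0, 0;
      0, br (q * z), 0, s, 0, 0;
      0, 0, br z, 0, s, 0;
      0, s, 0, br z, 0, 0;
      0, 0, s, 0, br (q * z), 0;
      0, 0, 0, 0, 0, br (q ^ 2 * z)] : Matrix (Fin 6) (Fin 6) ℂ).submatrix pairIndex pairIndex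

/-- The operator on `ℂ² ⊗ (ℂ³)^{⊗N}` that acts as `R` on the auxiliary space and the `j`-th factor
and as the identity on the other factors. -/
def onSite {N : ℕ} (j : Fin N) (R : Matrix (Fin 2 × Fin 3) (Fin 2 × Fin 3) ℂ) :
    Matrix (Fin 2 × Conf N) (Fin 2 × Conf N) ℂ :=
  Matrix.of fun a b =>
    if ∀ k, k ≠ j → a.2 k = b.2 k then R (a.1, a.2 j) (b.1, b.2 j) else 0

section

variable {N : ℕ} (q s : ℂ) (w : Fin N → ℂ)

/-- The monodromy matrix
`R_{a,N}(q⁻¹z/w_N) R_{a,N-1}(q⁻¹z/w_{N-1}) ⋯ R_{a,1}(q⁻¹z/w_1)`. -/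
def monodromy (z : ℂ) : Matrix (Fin 2 × Conf N) (Fin 2 × Conf N) ℂ :=
  (List.ofFn fun j : Fin N => onSite j (R12 q s (q⁻¹ * z / w j))).reverse.prod

/-- The upper right block `𝓑(z)` of the monodromy matrix. -/
def opB (z : ℂ) : Matrix (Conf N) (Conf N) ℂ :=
  Matrix.of fun σ τ => monodromy q s w z (0, σ) (1, τ)

/-- The lower left block `𝓒(z)` of the monodromy matrix. -/
def opC (z : ℂ) : Matrix (Conf N) (Conf N) ℂ :=
  Matrix.of fun σ τ => monodromy q s w z (1, σ) (0, τ)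

/-- The anti-diagonal twist matrix on the auxiliary space. -/
def twistAD : Matrix (Fin 2) (Fin 2) ℂ := !![0, Complex.I; Complex.I, 0]

/-- The trace over the auxiliary space. -/
def trAux (X : Matrix (Fin 2 × Conf N) (Fin 2 × Conf N) ℂ) : Matrix (Conf N) (Conf N) ℂ :=
  Matrix.of fun σ τ => ∑ α, X (α, σ) (α, τ)

/-- The transfer matrix `T^{(1)}(z)` of the ten-vertex model with anti-diagonal twist. -/
def transferAD (z : ℂ) : Matrix (Conf N) (Conf N) ℂ :=
  trAux ((twistAD ⊗ₖ (1 : Matrix (Conf N) (Conf N) ℂ)) * monodromy q s w z)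

/-- `a(z) = ∏ᵢ [q z / wᵢ]`. -/
def aFun (z : ℂ) : ℂ := ∏ i, br (q * z / w i)

/-- `d(z) = ∏ᵢ [q⁻¹ z / wᵢ]`. -/
def dFun (z : ℂ) : ℂ := ∏ i, br (q⁻¹ * z / w i)

/-- The canonical basis vector labelled by `⇑ ⋯ ⇑`; also the components of its dual covector. -/
def allUp (N : ℕ) : Conf N → ℂ := Pi.single (fun _ => 0) 1

/-- The height state
`‖h⟩⟩ = ∏_j ∏_{l=0}^{h_j-1} (𝓑(q^{1-l} w_j) / a(q^{1-l} w_j)) |⇑ ⋯ ⇑⟩`.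
The operators `𝓑` commute with each other, so the order of the factors is immaterial; here `j`
and `l` increase from left to right. -/
def heightKet (h : Fin N → Fin 3) : Conf N → ℂ :=
  (List.ofFn fun j : Fin N =>
    ((List.range (h j)).map fun l : ℕ =>
      (aFun q w (q ^ (1 - (l : ℤ)) * w j))⁻¹ • opB q s w (q ^ (1 - (l : ℤ)) * w j)).prod).prod
    *ᵥ allUp N

/-- The dual height state
`⟨⟨h‖ = ⟨⇑ ⋯ ⇑| ∏_j ∏_{l=0}^{h_j-1} (𝓒(q^{1-l} w_j) / d(q^{-l} w_j))`,
with the same ordering convention (the operators `𝓒` commute with each other). -/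
def heightBra (h : Fin N → Fin 3) : Conf N → ℂ :=
  allUp N ᵥ*
    (List.ofFn fun j : Fin N =>
      ((List.range (h j)).map fun l : ℕ =>
        (dFun q w (q ^ (-(l : ℤ)) * w j))⁻¹ • opC q s w (q ^ (1 - (l : ℤ)) * w j)).prod).prod

/-- Inhomogeneity parameters for which the height states are well defined and independent:
they are non-zero and `w_i² ≠ q^{2m} w_j²` for `i ≠ j` and `m = -2, …, 2`. -/
def GenericInhom : Prop :=
  (∀ i, w i ≠ 0) ∧
    ∀ i j, i ≠ j → ∀ m : ℤ, |m| ≤ 2 → w i ^ 2 ≠ q ^ (2 * m) * w j ^ 2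

end

end TenVertex

end

namespace TenVertex

/-! ### Trigonometric polynomials of definite parity -/

/-! The matrix elements of B(z) and C(z) involve only the N monomials z^(1-N), z^(3-N), …, z^(N-1),
so they are determined by their values at N points with distinct squares. For the height state
labelled by h these points are its nodes q^(1-h_j) w_j. There the Yang–Baxter algebra acts simply: D
annihilates the state (`HeightSystem.D_node`), B raises h_j by definition and annihilates the state
if h_j = 2 (`HeightPair.B_node_of_eq_two`), and C annihilates it if h_j = 0
(`HeightSystem.C_node_of_eq_zero`) and otherwise lowers h_j, by the quantum determinant
(`HeightSystem.C_node_bump`).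

Interpolation at the nodes then gives biorthogonality of bras and kets (`HeightPair.orthogonal`) and
a recursion for their norms with non-zero coefficients (`HeightPair.norm_bump`). Since there are 3^N
labels, both families are bases.

A covector annihilated by every B(z) + C(z) is tested on each height state at its nodes. A node of
height 0 forces the component of height 1 to vanish; a node of height 1 relates the components of
heights 2 and 0. Hence the components factorise and the common kernel is a line
(`HeightPair.exists_leftKernel`). Transposition exchanges B with C and kets with bras, so the right
kernel is the same statement for `HeightPair.dual`.

For simplicity of the eigenvalue, suppose that the left and right null vectors have non-zero
overlap. The hyperplane annihilated by the left one is invariant under the commuting matrices T(z)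
and does not contain the right one. Each of the finitely many joint eigenvalues on it is
trigonometric in z and not identically zero, so outside a finite set T(z) is injective there
(`finite_rootMultiplicity_ne_one`). The overlap, expanded in height states, is a sum over subsets of
the sites (`HeightPair.dotProduct_eq_sum_cutProd`). Cleared of denominators it is a polynomial in
the w_i, and it is non-zero because for w_i = t^i and t → 0 each of the 2^N terms tends to 1
(`overlapPoly_ne_zero`). -/

/-- `f` is, away from `0`, a linear combination of the `n` monomials
`z^(1-n), z^(3-n), …, z^(n-1)`. -/
def IsTrig (n : ℕ) (f : ℂ → ℂ) : Prop :=
  ∃ p : Polynomial ℂ, p.degree < n ∧ ∀ z, z ≠ 0 → z ^ n * f z = z * p.eval (z ^ 2)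

theorem IsTrig.congr {n : ℕ} {f g : ℂ → ℂ} (hf : IsTrig n f) (h : ∀ z, z ≠ 0 → f z = g z) :
    IsTrig n g := by
  obtain ⟨p, hp, hz⟩ := hf
  exact ⟨p, hp, fun z h0 => by rw [← h z h0, hz z h0]⟩

theorem isTrig_zero (n : ℕ) : IsTrig n (fun _ => 0) :=
  ⟨0, by simp, fun z _ => by simp⟩

theorem IsTrig.add {n : ℕ} {f g : ℂ → ℂ} (hf : IsTrig n f) (hg : IsTrig n g) :
    IsTrig n (fun z => f z + g z) := by
  obtain ⟨p, hp, hz⟩ := hf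
  obtain ⟨p', hp', hz'⟩ := hg
  refine ⟨p + p', (Polynomial.degree_add_le _ _).trans_lt (max_lt hp hp'), fun z h0 => ?_⟩
  rw [mul_add, hz z h0, hz' z h0, Polynomial.eval_add, mul_add]

theorem IsTrig.const_mul {n : ℕ} {f : ℂ → ℂ} (c : ℂ) (hf : IsTrig n f) :
    IsTrig n (fun z => c * f z) := by
  obtain ⟨p, hp, hz⟩ := hf
  refine ⟨Polynomial.C c * p, ?_, fun z h0 => ?_⟩
  · rw [← Polynomial.smul_eq_C_mul]
    exact (Polynomial.degree_smul_le _ _).trans_lt hp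
  · rw [mul_left_comm, hz z h0, Polynomial.eval_mul, Polynomial.eval_C]
    ring

theorem IsTrig.sum {n : ℕ} {ι : Type*} (s : Finset ι) {f : ι → ℂ → ℂ}
    (hf : ∀ i ∈ s, IsTrig n (f i)) : IsTrig n (fun z => ∑ i ∈ s, f i z) := by
  classical
  induction s using Finset.induction_on with
  | empty => simpa using isTrig_zero n
  | insert a s ha ih =>
    simp only [Finset.sum_insert ha]
    exact (hf a (Finset.mem_insert_self _ _)).add
      (ih fun i hi => hf i (Finset.mem_insert_of_mem hi))

theorem isTrig_zero_iff {f : ℂ → ℂ} : IsTrig 0 f ↔ ∀ z, z ≠ 0 → f z = 0 := by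
  constructor
  · rintro ⟨p, hp, hz⟩ z h0
    have : p = 0 := by
      rw [← Polynomial.degree_eq_bot]
      simpa [Nat.WithBot.lt_zero_iff] using hp
    simpa [this] using hz z h0
  · intro h
    exact (isTrig_zero 0).congr fun z h0 => (h z h0).symm

/-- The exponents add up to a range of m + n - 1 monomials of one parity; writing this as m + n = k
+ 1 avoids truncated subtraction. -/
theorem IsTrig.mul {m n k : ℕ} {f g : ℂ → ℂ} (hf : IsTrig m f) (hg : IsTrig n g)
    (hk : m + n = k + 1) : IsTrig k (fun z => f z * g z) := by
  rcases Nat.eq_zero_or_pos m with rfl | hm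
  · exact (isTrig_zero k).congr fun z h0 => by rw [isTrig_zero_iff.1 hf z h0, zero_mul]
  rcases Nat.eq_zero_or_pos n with rfl | hn
  · exact (isTrig_zero k).congr fun z h0 => by rw [isTrig_zero_iff.1 hg z h0, mul_zero]
  obtain ⟨p, hp, hz⟩ := hf
  obtain ⟨p', hp', hz'⟩ := hg
  refine ⟨p * p', ?_, fun z h0 => ?_⟩
  · by_cases h : p * p' = 0
    · rw [h]; simp
    · have h1 : p ≠ 0 := left_ne_zero_of_mul h
      have h2 : p' ≠ 0 := right_ne_zero_of_mul h
      rw [← Polynomial.natDegree_lt_iff_degree_lt h]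
      rw [← Polynomial.natDegree_lt_iff_degree_lt h1] at hp
      rw [← Polynomial.natDegree_lt_iff_degree_lt h2] at hp'
      rw [Polynomial.natDegree_mul h1 h2]
      omega
  · have : z ^ m * f z * (z ^ n * g z) = _ := congrArg₂ (· * ·) (hz z h0) (hz' z h0)
    apply mul_left_cancel₀ h0
    rw [Polynomial.eval_mul]
    calc z * (z ^ k * (f z * g z)) = z ^ (k + 1) * (f z * g z) := by ring
      _ = z ^ m * f z * (z ^ n * g z) := by rw [← hk]; ring
      _ = _ := by rw [this]; ring

/-- Enlarging the range by one monomial at each end preserves the parity of the exponents, which a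
step from n to n + 1 would change. -/
theorem IsTrig.add_two {n : ℕ} {f : ℂ → ℂ} (hf : IsTrig n f) : IsTrig (n + 2) f := by
  obtain ⟨p, hp, hz⟩ := hf
  refine ⟨Polynomial.X * p, ?_, fun z h0 => ?_⟩
  · by_cases h1 : p = 0
    · rw [h1, mul_zero]; exact WithBot.bot_lt_coe _
    · have h := mul_ne_zero Polynomial.X_ne_zero h1
      rw [← Polynomial.natDegree_lt_iff_degree_lt h]
      rw [← Polynomial.natDegree_lt_iff_degree_lt h1] at hp
      rw [Polynomial.natDegree_X_mul h1]
      omega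
  · rw [pow_add, mul_right_comm, hz z h0, Polynomial.eval_mul, Polynomial.eval_X]
    ring

theorem isTrig_const (c : ℂ) : IsTrig 1 (fun _ => c) :=
  ⟨Polynomial.C c, (Polynomial.degree_C_le).trans_lt (by norm_num), fun z _ => by simp⟩

theorem isTrig_br (c : ℂ) : IsTrig 2 (fun z => br (c * z)) := by
  refine ⟨Polynomial.C c * Polynomial.X + Polynomial.C (-c⁻¹),
    (Polynomial.degree_linear_le).trans_lt (by norm_num), fun z h0 => ?_⟩
  simp only [br, Polynomial.eval_add, Polynomial.eval_mul, Polynomial.eval_C, Polynomial.eval_X,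
    mul_inv]
  field_simp
  ring

theorem isTrig_prod_br {ι : Type*} (s : Finset ι) (c : ι → ℂ) :
    IsTrig (s.card + 1) (fun z => ∏ i ∈ s, br (c i * z)) := by
  classical
  induction s using Finset.induction_on with
  | empty => simpa using isTrig_const 1
  | insert a s ha ih =>
    simp only [Finset.prod_insert ha, Finset.card_insert_of_notMem ha]
    exact (isTrig_br (c a)).mul ih (by ring)

/-- Up to a power of z, `f` is a polynomial of degree below n in z², and it has the n distinct roots
u_i². -/
theorem IsTrig.eq_zero_of_nodes {n : ℕ} {f : ℂ → ℂ} (hf : IsTrig n f) {u : Fin n → ℂ}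
    (hu0 : ∀ i, u i ≠ 0) (hu : ∀ i j, i ≠ j → u i ^ 2 ≠ u j ^ 2) (h : ∀ i, f (u i) = 0)
    {z : ℂ} (hz : z ≠ 0) : f z = 0 := by
  obtain ⟨p, hp, hpz⟩ := hf
  have hp0 : p = 0 := by
    refine Polynomial.eq_zero_of_degree_lt_of_eval_index_eq_zero (s := Finset.univ)
      (v := fun i => u i ^ 2) ?_ (by simpa using hp) ?_
    · intro i _ j _ hij
      by_contra hne
      exact hu i j hne hij
    · intro i _
      have := hpz (u i) (hu0 i)
      rw [h i, mul_zero] at this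
      exact (mul_eq_zero.1 this.symm).resolve_left (hu0 i)
  have := hpz z hz
  rw [hp0, Polynomial.eval_zero, mul_zero] at this
  exact (mul_eq_zero.1 this).resolve_left (pow_ne_zero _ hz)

theorem br_one : br 1 = 0 := by simp [br]

theorem br_inv (z : ℂ) : br z⁻¹ = -br z := by simp [br]

theorem br_eq_zero_iff {z : ℂ} (hz : z ≠ 0) : br z = 0 ↔ z ^ 2 = 1 := by
  have : br z = (z ^ 2 - 1) / z := by rw [br]; field_simp
  rw [this, div_eq_zero_iff, sub_eq_zero]
  simp [hz]

theorem br_div_ne_zero {u v : ℂ} (hu : u ≠ 0) (hv : v ≠ 0) (h : u ^ 2 ≠ v ^ 2) :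
    br (u / v) ≠ 0 := by
  rw [Ne, br_eq_zero_iff (div_ne_zero hu hv), div_pow, div_eq_one_iff_eq (pow_ne_zero _ hv)]
  exact h

/-- Two-point interpolation for a trigonometric polynomial that vanishes at all nodes but one. -/
theorem IsTrig.interpolate {n : ℕ} {f : ℂ → ℂ} (hf : IsTrig n f) {u : Fin n → ℂ}
    (hu0 : ∀ i, u i ≠ 0) (hu : ∀ i j, i ≠ j → u i ^ 2 ≠ u j ^ 2) {j : Fin n}
    (h : ∀ i, i ≠ j → f (u i) = 0) {z : ℂ} (hz : z ≠ 0) :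
    f z * ∏ k ∈ Finset.univ.erase j, br (u j / u k) =
      f (u j) * ∏ k ∈ Finset.univ.erase j, br (z / u k) := by
  set p := ∏ k ∈ Finset.univ.erase j, br (u j / u k) with hp
  have hcard : (Finset.univ.erase j).card + 1 = n := by
    rw [Finset.card_erase_add_one (Finset.mem_univ _), Finset.card_univ, Fintype.card_fin]
  have hT : IsTrig n (fun z => ∏ k ∈ Finset.univ.erase j, br (z / u k)) := by
    have := isTrig_prod_br (Finset.univ.erase j) (fun k => (u k)⁻¹)
    rw [hcard] at this
    exact this.congr fun z _ => by simp only [div_eq_inv_mul]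
  -- The difference of the two sides vanishes at every node: away from j, the product contains the
  -- factor [u_i/u_i] = 0.
  have key := ((hf.const_mul p).add (hT.const_mul (-f (u j)))).eq_zero_of_nodes hu0 hu
    (fun i => ?_) hz
  · linear_combination key
  · by_cases hij : i = j
    · subst hij; rw [← hp]; ring
    · rw [h i hij, Finset.prod_eq_zero (Finset.mem_erase.2 ⟨hij, Finset.mem_univ i⟩)]
      · ring
      · rw [div_self (hu0 i), br_one]

theorem IsTrig.finite_zeros {n : ℕ} {f : ℂ → ℂ} (hf : IsTrig n f) {z₀ : ℂ} (hz₀ : z₀ ≠ 0)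
    (h : f z₀ ≠ 0) : {z : ℂ | z ≠ 0 ∧ f z = 0}.Finite := by
  obtain ⟨p, hp, hpz⟩ := hf
  have hp0 : p.comp (Polynomial.X ^ 2) ≠ 0 := by
    intro h0
    have h1 := congrArg (Polynomial.eval z₀) h0
    have h2 := hpz z₀ hz₀
    simp only [Polynomial.eval_comp, Polynomial.eval_pow, Polynomial.eval_X,
      Polynomial.eval_zero] at h1
    rw [h1, mul_zero] at h2
    exact mul_ne_zero (pow_ne_zero _ hz₀) h h2
  refine (p.comp (Polynomial.X ^ 2)).roots.toFinset.finite_toSet.subset ?_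
  rintro z ⟨hz, hfz⟩
  simp only [Finset.mem_coe, Multiset.mem_toFinset, Polynomial.mem_roots hp0,
    Polynomial.IsRoot.def, Polynomial.eval_comp, Polynomial.eval_pow, Polynomial.eval_X]
  have h2 := hpz z hz
  rw [hfz, mul_zero] at h2
  exact (mul_eq_zero.1 h2.symm).resolve_left hz

theorem isTrig_dotProduct_mulVec {N : ℕ} {n : Type*} [Fintype n]
    {M : ℂ → Matrix n n ℂ} (hM : ∀ σ τ, IsTrig N fun z => M z σ τ)
    (x y : n → ℂ) : IsTrig N fun z => x ⬝ᵥ (M z *ᵥ y) := by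
  have : IsTrig N fun z => ∑ σ, ∑ τ, x σ * y τ * M z σ τ :=
    IsTrig.sum _ fun σ _ => IsTrig.sum _ fun τ _ => (hM σ τ).const_mul _
  refine this.congr fun z _ => ?_
  simp only [dotProduct, Matrix.mulVec, Finset.mul_sum]
  exact Finset.sum_congr rfl fun σ _ => Finset.sum_congr rfl fun τ _ => by ring

/-! ### Heights and their nodes -/

section Heights

variable {N : ℕ}

/-- Raise the `j`-th height by one. -/
def bump (h : Fin N → ℕ) (j : Fin N) : Fin N → ℕ := Function.update h j (h j + 1)

/-- The point `q^(1-h_j) w_j`. -/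
noncomputable def node (q : ℂ) (w : Fin N → ℂ) (h : Fin N → ℕ) (j : Fin N) : ℂ :=
  q ^ (1 - (h j : ℤ)) * w j

theorem bump_self (h : Fin N → ℕ) (j : Fin N) : bump h j j = h j + 1 := by simp [bump]

theorem bump_of_ne (h : Fin N → ℕ) {j k : Fin N} (hk : k ≠ j) : bump h j k = h k := by
  simp [bump, hk]

theorem exists_bump_of_pos {h : Fin N → ℕ} {j : Fin N} (hj : 0 < h j) : ∃ g, h = bump g j := by
  refine ⟨Function.update h j (h j - 1), ?_⟩
  funext k
  by_cases hk : k = j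
  · subst hk; simp [bump]; omega
  · simp [bump, hk]

theorem sum_bump (h : Fin N → ℕ) (j : Fin N) : ∑ i, bump h j i = ∑ i, h i + 1 := by
  rw [← Finset.add_sum_erase _ _ (Finset.mem_univ j),
    ← Finset.add_sum_erase _ h (Finset.mem_univ j), bump_self,
    Finset.sum_congr rfl fun i hi => bump_of_ne h (Finset.ne_of_mem_erase hi)]
  ring

theorem exists_bump_of_ne_zero {h : Fin N → ℕ} (h0 : h ≠ 0) : ∃ g j, h = bump g j := by
  obtain ⟨j, hj⟩ := Function.ne_iff.1 h0
  obtain ⟨g, hg⟩ := exists_bump_of_pos (Nat.pos_of_ne_zero hj)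
  exact ⟨g, j, hg⟩

theorem bump_induction {P : (Fin N → ℕ) → Prop} (zero : P 0)
    (step : ∀ g j, P g → P (bump g j)) (h : Fin N → ℕ) : P h := by
  induction hn : ∑ i, h i using Nat.strong_induction_on generalizing h with
  | _ n ih =>
    by_cases h0 : h = 0
    · rwa [h0]
    · obtain ⟨g, j, rfl⟩ := exists_bump_of_ne_zero h0
      exact step g j (ih _ (by rw [← hn, sum_bump]; omega) g rfl)

theorem le_two_of_bump {h : Fin N → ℕ} {j : Fin N} (H : ∀ i, bump h j i ≤ 2) :
    (∀ i, h i ≤ 2) ∧ h j ≤ 1 := by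
  refine ⟨fun i => ?_, ?_⟩
  · have := H i
    by_cases hi : i = j
    · subst hi; rw [bump_self] at this; omega
    · rwa [bump_of_ne _ hi] at this
  · have := H j
    rw [bump_self] at this; omega

theorem bump_le_two {h : Fin N → ℕ} {j : Fin N} (H : ∀ i, h i ≤ 2) (hj : h j ≤ 1) (i : Fin N) :
    bump h j i ≤ 2 := by
  by_cases hi : i = j
  · subst hi; rw [bump_self]; omega
  · rw [bump_of_ne _ hi]; exact H i

variable {q : ℂ} {w : Fin N → ℂ}

theorem node_bump_of_ne (h : Fin N → ℕ) {j k : Fin N} (hk : k ≠ j) :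
    node q w (bump h j) k = node q w h k := by
  rw [node, node, bump_of_ne _ hk]

theorem node_bump_self (hq : q ≠ 0) (h : Fin N → ℕ) (j : Fin N) :
    node q w (bump h j) j = q⁻¹ * node q w h j := by
  rw [node, node, bump_self, ← mul_assoc, ← zpow_neg_one, ← zpow_add₀ hq]
  congr 2
  push_cast
  ring

theorem node_ne_zero (hq : q ≠ 0) (hw : GenericInhom q w) (h : Fin N → ℕ) (j : Fin N) :
    node q w h j ≠ 0 :=
  mul_ne_zero (zpow_ne_zero _ hq) (hw.1 j)

theorem GenericInhom.br_ne_zero (hq : q ≠ 0) (hw : GenericInhom q w) {i j : Fin N} (hij : i ≠ j)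
    {m : ℤ} (hm : |m| ≤ 2) : br (q ^ m * w i / w j) ≠ 0 := by
  refine br_div_ne_zero (mul_ne_zero (zpow_ne_zero _ hq) (hw.1 i)) (hw.1 j) ?_
  rw [mul_pow, ← zpow_natCast, ← zpow_mul, mul_comm m]
  exact fun h => hw.2 j i hij.symm m hm h.symm

/-- Coinciding squares of nodes would give w_i² = q^(2m) w_j² with m = h_i - h_j, and heights up to
2 give |m| ≤ 2: exactly the excluded range. -/
theorem node_sq_ne (hq : q ≠ 0) (hw : GenericInhom q w) {h : Fin N → ℕ} (hh : ∀ i, h i ≤ 2)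
    (i j : Fin N) (hij : i ≠ j) : node q w h i ^ 2 ≠ node q w h j ^ 2 := by
  intro e
  have hm : |(h i : ℤ) - h j| ≤ 2 := by
    have := hh i
    have := hh j
    rw [abs_le]; constructor <;> omega
  apply hw.2 i j hij _ hm
  have h1 : q ^ (2 * (1 - (h i : ℤ))) ≠ 0 := zpow_ne_zero _ hq
  apply mul_left_cancel₀ h1
  rw [← mul_assoc, ← zpow_add₀ hq]
  have sq : ∀ a : ℤ, (q ^ a) ^ 2 = q ^ (2 * a) := fun a => by
    rw [← zpow_natCast, ← zpow_mul, mul_comm, Nat.cast_ofNat]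
  rw [node, node, mul_pow, mul_pow, sq, sq] at e
  rw [e]
  congr 2
  ring

theorem br_q_ne_zero (hq : q ≠ 0) (hq4 : q ^ 4 ≠ 1) : br q ≠ 0 := by
  rw [Ne, br_eq_zero_iff hq]
  intro h
  apply hq4
  linear_combination (q ^ 2 + 1) * h

theorem br_q_sq_ne_zero (hq : q ≠ 0) (hq4 : q ^ 4 ≠ 1) : br (q ^ 2) ≠ 0 := by
  rw [Ne, br_eq_zero_iff (pow_ne_zero _ hq)]
  intro h
  apply hq4
  linear_combination h

end Heights

/-! ### Height states in an abstract Yang–Baxter algebra -/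

section AbstractHeights

variable {N : ℕ} {n : Type*} [Fintype n] [DecidableEq n]

/-- The part of the Yang–Baxter algebra that determines the action of `B`, `C`, `D` on the height
states `K h`, obtained from a pseudo-vacuum `K 0` by the action of `B`. -/
structure HeightSystem (q : ℂ) (w : Fin N → ℂ) (A B C D : ℂ → Matrix n n ℂ) (c e : ℂ → ℂ)
    (K : (Fin N → ℕ) → n → ℂ) : Prop where
  rel_DB : ∀ u v, u ≠ 0 → v ≠ 0 →
    br (u / v) • (D u * B v) = br (q * u / v) • (B v * D u) - br q • (B u * D v)
  rel_CB : ∀ u v, u ≠ 0 → v ≠ 0 →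
    br (u / v) • (C u * B v - B v * C u) = br q • (A v * D u - A u * D v)
  rel_det : ∀ v, v ≠ 0 → A (q⁻¹ * v) * D v - C (q⁻¹ * v) * B v = (c v * e v) • 1
  D_vac : ∀ j, D (q * w j) *ᵥ K 0 = 0
  C_vac : ∀ u, u ≠ 0 → C u *ᵥ K 0 = 0
  step : ∀ h j, h j ≤ 1 → B (node q w h j) *ᵥ K h = c (node q w h j) • K (bump h j)
  c_ne : ∀ h j, h j ≤ 1 → c (node q w h j) ≠ 0

namespace HeightSystem

variable {q : ℂ} {w : Fin N → ℂ} {A B C D : ℂ → Matrix n n ℂ} {c e : ℂ → ℂ}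
  {K : (Fin N → ℕ) → n → ℂ}

theorem K_bump (S : HeightSystem q w A B C D c e K) {h : Fin N → ℕ} {j : Fin N} (hj : h j ≤ 1) :
    K (bump h j) = (c (node q w h j))⁻¹ • (B (node q w h j) *ᵥ K h) := by
  rw [S.step h j hj, smul_smul, inv_mul_cancel₀ (S.c_ne h j hj), one_smul]

/-- By induction on the heights, D is moved past the last B. The exchanged term ends in D at a node
of the lower state and vanishes. The direct term vanishes by induction at an unchanged node; at the
lowered node u = q⁻¹v its coefficient is [1] = 0. -/
theorem D_node (S : HeightSystem q w A B C D c e K) (hq : q ≠ 0) (hq4 : q ^ 4 ≠ 1)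
    (hw : GenericInhom q w) (h : Fin N → ℕ) :
    (∀ i, h i ≤ 2) → ∀ k, D (node q w h k) *ᵥ K h = 0 := by
  induction h using bump_induction with
  | zero => intro _ k; simpa [node] using S.D_vac k
  | step g j ih =>
    intro hh k
    obtain ⟨hg, hj⟩ := le_two_of_bump hh
    have hv := node_ne_zero hq hw g j
    have key : ∀ u, u ≠ 0 → br (u / node q w g j) ≠ 0 →
        br (q * u / node q w g j) • (D u *ᵥ K g) = 0 → D u *ᵥ K (bump g j) = 0 := by
      intro u hu h1 h2
      have h3 := congrArg (· *ᵥ K g) (S.rel_DB u _ hu hv)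
      simp only [Matrix.smul_mulVec, Matrix.sub_mulVec, ← Matrix.mulVec_mulVec, ih hg j,
        Matrix.mulVec_zero, smul_zero, sub_zero] at h3
      rw [← Matrix.mulVec_smul (B _), h2, Matrix.mulVec_zero] at h3
      rw [S.K_bump hj, Matrix.mulVec_smul, (smul_eq_zero.1 h3).resolve_left h1, smul_zero]
    by_cases hk : k = j
    · subst hk
      rw [node_bump_self hq]
      refine key _ (mul_ne_zero (inv_ne_zero hq) hv) ?_ ?_
      · rw [mul_div_assoc, div_self hv, mul_one, br_inv]
        exact neg_ne_zero.2 (br_q_ne_zero hq hq4)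
      · rw [mul_inv_cancel_left₀ hq, div_self hv, br_one, zero_smul]
    · rw [node_bump_of_ne _ hk]
      refine key _ (node_ne_zero hq hw g k)
        (br_div_ne_zero (node_ne_zero hq hw g k) hv (node_sq_ne hq hw hg _ _ hk)) ?_
      rw [ih hg k, smul_zero]

/-- C can be moved past each B down to the vacuum, because the commutator terms end in D at nodes.
-/
theorem C_node_of_eq_zero (S : HeightSystem q w A B C D c e K) (hq : q ≠ 0) (hq4 : q ^ 4 ≠ 1)
    (hw : GenericInhom q w) (h : Fin N → ℕ) :
    (∀ i, h i ≤ 2) → ∀ k, h k = 0 → C (node q w h k) *ᵥ K h = 0 := by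
  induction h using bump_induction with
  | zero => intro _ k _; exact S.C_vac _ (node_ne_zero hq hw _ _)
  | step g j ih =>
    intro hh k hk0
    obtain ⟨hg, hj⟩ := le_two_of_bump hh
    have hk : k ≠ j := by
      rintro rfl
      rw [bump_self] at hk0
      omega
    rw [bump_of_ne _ hk] at hk0
    rw [node_bump_of_ne _ hk]
    have hu := node_ne_zero hq hw g k
    have hv := node_ne_zero hq hw g j
    have h3 := congrArg (· *ᵥ K g) (S.rel_CB _ _ hu hv)
    simp only [Matrix.smul_mulVec, Matrix.sub_mulVec, ← Matrix.mulVec_mulVec, ih hg k hk0,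
      S.D_node hq hq4 hw g hg, Matrix.mulVec_zero, smul_zero, sub_zero] at h3
    rw [S.K_bump hj, Matrix.mulVec_smul, (smul_eq_zero.1 h3).resolve_left
      (br_div_ne_zero hu hv (node_sq_ne hq hw hg _ _ hk)), smul_zero]

/-- The lowered node is q⁻¹v, so C(q⁻¹v)B(v) occurs in the quantum determinant at v, whose other
term ends in D(v) and vanishes on the state. -/
theorem C_node_bump (S : HeightSystem q w A B C D c e K) (hq : q ≠ 0) (hq4 : q ^ 4 ≠ 1)
    (hw : GenericInhom q w) {g : Fin N → ℕ} (hg : ∀ i, g i ≤ 2) {j : Fin N} (hj : g j ≤ 1) :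
    C (node q w (bump g j) j) *ᵥ K (bump g j) = -e (node q w g j) • K g := by
  have hc := S.c_ne g j hj
  have h3 := congrArg (· *ᵥ K g) (S.rel_det _ (node_ne_zero hq hw g j))
  simp only [Matrix.smul_mulVec, Matrix.sub_mulVec, ← Matrix.mulVec_mulVec, Matrix.one_mulVec,
    S.D_node hq hq4 hw g hg, Matrix.mulVec_zero, zero_sub] at h3
  rw [S.K_bump hj, Matrix.mulVec_smul, node_bump_self hq, neg_eq_iff_eq_neg.1 h3, ← smul_neg,
    mul_smul, inv_smul_smul₀ hc, neg_smul, smul_neg]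

end HeightSystem

/-- Two height systems, for vectors and for covectors, that are exchanged by transposition. -/
structure HeightPair (q : ℂ) (w : Fin N → ℂ) (A B C D : ℂ → Matrix n n ℂ) (c e : ℂ → ℂ)
    (K L : (Fin N → ℕ) → n → ℂ) : Prop where
  hq : q ≠ 0
  hq4 : q ^ 4 ≠ 1
  hw : GenericInhom q w
  ket : HeightSystem q w A B C D c e K
  bra : HeightSystem q w (fun z => (A z)ᵀ) (fun z => (C z)ᵀ) (fun z => (B z)ᵀ) (fun z => (D z)ᵀ)
    e c L
  trig_B : ∀ σ τ, IsTrig N fun z => B z σ τ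
  trig_C : ∀ σ τ, IsTrig N fun z => C z σ τ
  vac : L 0 ⬝ᵥ K 0 = 1

namespace HeightPair

variable {q : ℂ} {w : Fin N → ℂ} {A B C D : ℂ → Matrix n n ℂ} {c e : ℂ → ℂ}
  {K L : (Fin N → ℕ) → n → ℂ}

/-- This symmetry halves the work: every statement about covectors and `K` yields one about vectors
and `L`, with `c` and `e` exchanged. -/
theorem dual (S : HeightPair q w A B C D c e K L) :
    HeightPair q w (fun z => (A z)ᵀ) (fun z => (C z)ᵀ) (fun z => (B z)ᵀ) (fun z => (D z)ᵀ)
      e c L K where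
  hq := S.hq
  hq4 := S.hq4
  hw := S.hw
  ket := S.bra
  bra := by simpa using S.ket
  trig_B := fun σ τ => S.trig_C τ σ
  trig_C := fun σ τ => S.trig_B τ σ
  vac := by rw [dotProduct_comm]; exact S.vac

theorem L_bump_dotProduct (S : HeightPair q w A B C D c e K L) {g : Fin N → ℕ} {j : Fin N}
    (hj : g j ≤ 1) (x : n → ℂ) :
    e (node q w g j) * (L (bump g j) ⬝ᵥ x) = L g ⬝ᵥ (C (node q w g j) *ᵥ x) := by
  rw [← smul_eq_mul, ← smul_dotProduct, ← S.bra.step g j hj, Matrix.mulVec_transpose,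
    Matrix.dotProduct_mulVec]

/-- The pairing of a dual height state with `C K h` at a node of `h` vanishes unless it lowers
`h` to that dual height. -/
theorem dotProduct_C_node (S : HeightPair q w A B C D c e K L) {h g : Fin N → ℕ}
    (hh : ∀ i, h i ≤ 2)
    (orth : ∀ h' : Fin N → ℕ, (∀ i, h' i ≤ 2) → h' ≠ g → L g ⬝ᵥ K h' = 0) {k : Fin N}
    (hk : h ≠ bump g k) : L g ⬝ᵥ (C (node q w h k) *ᵥ K h) = 0 := by
  rcases Nat.eq_zero_or_pos (h k) with h0 | hpos
  · rw [S.ket.C_node_of_eq_zero S.hq S.hq4 S.hw h hh k h0, dotProduct_zero]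
  · obtain ⟨f, rfl⟩ := exists_bump_of_pos hpos
    obtain ⟨hf, hfk⟩ := le_two_of_bump hh
    rw [S.ket.C_node_bump S.hq S.hq4 S.hw hf hfk, dotProduct_smul,
      orth f hf (by rintro rfl; exact hk rfl), smul_zero]

/-- Induction on the bra: its last C is applied to the ket, and the resulting trigonometric
polynomial is examined at the nodes of the ket, where C lowers one height and the induction
hypothesis applies. -/
theorem orthogonal (S : HeightPair q w A B C D c e K L) (h' : Fin N → ℕ) :
    (∀ i, h' i ≤ 2) → ∀ h : Fin N → ℕ, (∀ i, h i ≤ 2) → h ≠ h' → L h' ⬝ᵥ K h = 0 := by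
  induction h' using bump_induction with
  | zero =>
    intro _ h hh h0
    obtain ⟨g, j, rfl⟩ := exists_bump_of_ne_zero h0
    obtain ⟨hg, hgj⟩ := le_two_of_bump hh
    rw [S.ket.K_bump hgj, dotProduct_smul, Matrix.dotProduct_mulVec, ← Matrix.mulVec_transpose,
      S.bra.C_vac _ (node_ne_zero S.hq S.hw g j), zero_dotProduct, smul_zero]
  | step g j ih =>
    intro hh' h hh hne
    obtain ⟨hg, hgj⟩ := le_two_of_bump hh'
    have he := S.bra.c_ne g j hgj
    apply (mul_eq_zero.1 (?_ : e (node q w g j) * (L (bump g j) ⬝ᵥ K h) = 0)).resolve_left he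
    rw [S.L_bump_dotProduct hgj]
    by_cases hk : ∃ k, h = bump g k
    · obtain ⟨k, rfl⟩ := hk
      have hkj : j ≠ k := by rintro rfl; exact hne rfl
      -- Since j ≠ k, the point at which C is evaluated is itself a node of the ket, so no
      -- interpolation is needed.
      rw [← node_bump_of_ne g hkj]
      refine S.dotProduct_C_node hh (ih hg) fun e' => ?_
      have := congrFun e' j
      rw [bump_self, bump_of_ne _ hkj] at this
      omega
    · push Not at hk
      exact (isTrig_dotProduct_mulVec S.trig_C (L g) (K h)).eq_zero_of_nodes
        (node_ne_zero S.hq S.hw h) (node_sq_ne S.hq S.hw hh)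
        (fun k => S.dotProduct_C_node hh (ih hg) (hk k)) (node_ne_zero S.hq S.hw g j)

/-- The matrix element of C(z) between the lower bra and the raised ket vanishes at all nodes of
that ket but the j-th. Interpolation relates its value there, minus e times the lower norm, to its
value at the j-th node of the lower state, e times the raised norm. -/
theorem norm_bump (S : HeightPair q w A B C D c e K L) {g : Fin N → ℕ} (hg : ∀ i, g i ≤ 2)
    {j : Fin N} (hj : g j ≤ 1) :
    (L (bump g j) ⬝ᵥ K (bump g j)) *
        ∏ k ∈ Finset.univ.erase j, br (q⁻¹ * node q w g j / node q w g k) =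
      -(L g ⬝ᵥ K g) * ∏ k ∈ Finset.univ.erase j, br (node q w g j / node q w g k) := by
  have hh := bump_le_two hg hj
  have he := S.bra.c_ne g j hj
  have key := (isTrig_dotProduct_mulVec S.trig_C (L g) (K (bump g j))).interpolate
    (node_ne_zero S.hq S.hw (bump g j)) (node_sq_ne S.hq S.hw hh) (j := j)
    (fun k hk => S.dotProduct_C_node hh (S.orthogonal g hg) fun e' => by
      have := congrFun e' j
      rw [bump_self, bump_of_ne _ hk.symm] at this
      omega) (node_ne_zero S.hq S.hw g j)
  rw [← S.L_bump_dotProduct hj, S.ket.C_node_bump S.hq S.hq4 S.hw hg hj, dotProduct_smul,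
    smul_eq_mul, node_bump_self S.hq] at key
  have e1 : ∀ z, ∏ k ∈ Finset.univ.erase j, br (z / node q w (bump g j) k) =
      ∏ k ∈ Finset.univ.erase j, br (z / node q w g k) := fun z =>
    Finset.prod_congr rfl fun k hk => by rw [node_bump_of_ne _ (Finset.ne_of_mem_erase hk)]
  rw [e1, e1] at key
  apply mul_left_cancel₀ he
  linear_combination key

theorem norm_ne_zero (S : HeightPair q w A B C D c e K L) (h : Fin N → ℕ) :
    (∀ i, h i ≤ 2) → L h ⬝ᵥ K h ≠ 0 := by
  induction h using bump_induction with
  | zero => intro _; rw [S.vac]; exact one_ne_zero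
  | step g j ih =>
    intro hh h0
    obtain ⟨hg, hj⟩ := le_two_of_bump hh
    have := S.norm_bump hg hj
    rw [h0, zero_mul, eq_comm, mul_eq_zero, neg_eq_zero, Finset.prod_eq_zero_iff] at this
    rcases this with h1 | ⟨k, hk, h1⟩
    · exact ih hg h1
    · exact br_div_ne_zero (node_ne_zero S.hq S.hw g j) (node_ne_zero S.hq S.hw g k)
        (node_sq_ne S.hq S.hw hg _ _ (Finset.ne_of_mem_erase hk).symm) h1

end HeightPair

end AbstractHeights

/-! ### Completeness of the height states and the common kernel of B + C -/

/-- Heights with values in `{0, 1, 2}`, as natural numbers. -/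
def natHeights {N : ℕ} (h : Fin N → Fin 3) : Fin N → ℕ := fun i => h i

theorem natHeights_le {N : ℕ} (h : Fin N → Fin 3) (i : Fin N) : natHeights h i ≤ 2 :=
  Nat.le_of_lt_succ (h i).isLt

theorem natHeights_injective {N : ℕ} : Function.Injective (natHeights (N := N)) := fun _ _ e =>
  funext fun i => Fin.ext (congrFun e i)

theorem exists_natHeights {N : ℕ} {h : Fin N → ℕ} (hh : ∀ i, h i ≤ 2) :
    ∃ h', natHeights h' = h :=
  ⟨fun i => ⟨h i, Nat.lt_succ_of_le (hh i)⟩, rfl⟩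

theorem prod_bump {N : ℕ} (f : Fin N → ℕ → ℂ) (h : Fin N → ℕ) (j : Fin N) :
    ∏ i, f i (bump h j i) = f j (h j + 1) * ∏ i ∈ Finset.univ.erase j, f i (h i) := by
  rw [← Finset.mul_prod_erase _ _ (Finset.mem_univ j), bump_self,
    Finset.prod_congr rfl fun i hi => by rw [bump_of_ne h (Finset.ne_of_mem_erase hi)]]

theorem vecMul_add_dotProduct {n : Type*} [Fintype n] (B C : Matrix n n ℂ) (φ x : n → ℂ) :
    (φ ᵥ* (B + C)) ⬝ᵥ x = φ ⬝ᵥ (B *ᵥ x) + φ ⬝ᵥ (C *ᵥ x) := by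
  rw [← Matrix.dotProduct_mulVec, Matrix.add_mulVec, dotProduct_add]

namespace HeightPair

variable {N : ℕ} {n : Type*} [Fintype n] [DecidableEq n] {q : ℂ} {w : Fin N → ℂ}
  {A B C D : ℂ → Matrix n n ℂ} {c e : ℂ → ℂ} {K L : (Fin N → ℕ) → n → ℂ}

theorem dotProduct_sum (S : HeightPair q w A B C D c e K L) (x : (Fin N → Fin 3) → ℂ)
    (h : Fin N → Fin 3) :
    (∑ h', x h' • L (natHeights h')) ⬝ᵥ K (natHeights h) =
      x h * (L (natHeights h) ⬝ᵥ K (natHeights h)) := by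
  rw [sum_dotProduct, Finset.sum_eq_single h]
  · rw [smul_dotProduct, smul_eq_mul]
  · intro h' _ hne
    rw [smul_dotProduct, S.orthogonal _ (natHeights_le h') _ (natHeights_le h)
      (natHeights_injective.ne hne.symm), smul_zero]
  · simp

theorem linearIndependent_L (S : HeightPair q w A B C D c e K L) :
    LinearIndependent ℂ fun h : Fin N → Fin 3 => L (natHeights h) := by
  rw [Fintype.linearIndependent_iff]
  intro x hx h
  have := S.dotProduct_sum x h
  rw [hx, zero_dotProduct, eq_comm, mul_eq_zero] at this
  exact this.resolve_right (S.norm_ne_zero _ (natHeights_le h))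

theorem span_L (S : HeightPair q w A B C D c e K L) (hn : Fintype.card n = 3 ^ N) :
    Submodule.span ℂ (Set.range fun h : Fin N → Fin 3 => L (natHeights h)) = ⊤ := by
  apply S.linearIndependent_L.span_eq_top_of_card_eq_finrank'
  simp [hn]

theorem eq_zero_of_dotProduct_L (S : HeightPair q w A B C D c e K L)
    (hn : Fintype.card n = 3 ^ N) {x : n → ℂ}
    (hx : ∀ h : Fin N → ℕ, (∀ i, h i ≤ 2) → L h ⬝ᵥ x = 0) : x = 0 := by
  have key : ∀ y : n → ℂ, y ⬝ᵥ x = 0 := by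
    intro y
    have hy : y ∈ Submodule.span ℂ (Set.range fun h : Fin N → Fin 3 => L (natHeights h)) := by
      rw [S.span_L hn]; trivial
    induction hy using Submodule.span_induction with
    | mem y hy =>
      obtain ⟨h, rfl⟩ := hy
      exact hx _ (natHeights_le h)
    | zero => exact zero_dotProduct x
    | add y y' _ _ h h' => rw [add_dotProduct, h, h', add_zero]
    | smul a y _ h => rw [smul_dotProduct, h, smul_zero]
  funext σ
  simpa using key (Pi.single σ 1)

theorem eq_zero_of_dotProduct_K (S : HeightPair q w A B C D c e K L)
    (hn : Fintype.card n = 3 ^ N) {x : n → ℂ}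
    (hx : ∀ h : Fin N → ℕ, (∀ i, h i ≤ 2) → x ⬝ᵥ K h = 0) : x = 0 :=
  S.dual.eq_zero_of_dotProduct_L hn fun h hh => by rw [dotProduct_comm]; exact hx h hh

/-- `B` annihilates a height state at a node of maximal height. -/
theorem B_node_of_eq_two (S : HeightPair q w A B C D c e K L) (hn : Fintype.card n = 3 ^ N)
    {h : Fin N → ℕ} (hh : ∀ i, h i ≤ 2) {j : Fin N} (hj : h j = 2) :
    B (node q w h j) *ᵥ K h = 0 := by
  -- The relations of the algebra do not say this directly; completeness of the bras does. Read
  -- backwards, B lowers the bra at its nodes, and the one bra that could contribute would need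
  -- height 3 at site j.
  refine S.eq_zero_of_dotProduct_L hn fun h' hh' => ?_
  have orth : ∀ g : Fin N → ℕ, (∀ i, g i ≤ 2) → g ≠ h → K h ⬝ᵥ L g = 0 := fun g hg hne => by
    rw [dotProduct_comm]
    exact S.orthogonal _ hg _ hh hne.symm
  have eq : ∀ z, L h' ⬝ᵥ (B z *ᵥ K h) = K h ⬝ᵥ ((B z)ᵀ *ᵥ L h') := fun z => by
    rw [Matrix.mulVec_transpose, dotProduct_comm (K h), ← Matrix.dotProduct_mulVec]
  by_cases hk : ∃ k, h' = bump h k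
  · obtain ⟨k, rfl⟩ := hk
    have hkj : j ≠ k := by
      rintro rfl
      have := hh' j
      rw [bump_self] at this
      omega
    rw [eq, ← node_bump_of_ne h hkj]
    refine S.dual.dotProduct_C_node hh' orth fun e' => ?_
    have := congrFun e' j
    rw [bump_self, bump_of_ne _ hkj] at this
    omega
  · push Not at hk
    refine (isTrig_dotProduct_mulVec S.trig_B (L h') (K h)).eq_zero_of_nodes
        (node_ne_zero S.hq S.hw h') (node_sq_ne S.hq S.hw hh')
        (fun k => ?_) (node_ne_zero S.hq S.hw h j)
    rw [eq]
    exact S.dual.dotProduct_C_node hh' orth (hk k)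

theorem node_eq_of_eq_zero {h : Fin N → ℕ} {j : Fin N} (hj : h j = 0) :
    node q w h j = q * w j := by
  simp [node, hj]

theorem node_eq_of_eq_one {h : Fin N → ℕ} {j : Fin N} (hj : h j = 1) :
    node q w h j = w j := by
  simp [node, hj]

/-- The components of a covector in the common kernel of `B + C` along the height states. -/
theorem dotProduct_K_of_vecMul_eq_zero (S : HeightPair q w A B C D c e K L)
    {f : Fin N → ℕ → ℂ} (f0 : ∀ i, f i 0 = 1) (f1 : ∀ i, f i 1 = 0)
    (f2 : ∀ i, c (w i) * f i 2 = e (q * w i)) {φ : n → ℂ}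
    (hφ : ∀ z, z ≠ 0 → φ ᵥ* (B z + C z) = 0) (h : Fin N → ℕ) :
    (∀ i, h i ≤ 2) → φ ⬝ᵥ K h = (φ ⬝ᵥ K 0) * ∏ i, f i (h i) := by
  -- Strong induction is needed because the recursion connects heights that differ by two.
  induction hn : ∑ i, h i using Nat.strong_induction_on generalizing h with
  | _ n ih =>
    intro hh
    by_cases h0 : h = 0
    · simp [h0, f0]
    obtain ⟨g, j, rfl⟩ := exists_bump_of_ne_zero h0
    obtain ⟨hg, hj⟩ := le_two_of_bump hh
    have hc := S.ket.c_ne g j hj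
    have key := vecMul_add_dotProduct (B (node q w g j)) (C (node q w g j)) φ (K g)
    rw [hφ _ (node_ne_zero S.hq S.hw g j), zero_dotProduct, S.ket.step g j hj, dotProduct_smul,
      smul_eq_mul] at key
    rw [prod_bump]
    -- At height 0 only B contributes, which kills the component of height 1. At height 1 both
    -- operators contribute, and the components of heights 2 and 0 become proportional.
    rcases Nat.eq_zero_or_pos (g j) with hj0 | hpos
    · rw [S.ket.C_node_of_eq_zero S.hq S.hq4 S.hw g hg j hj0, dotProduct_zero, add_zero,
        eq_comm, mul_eq_zero] at key
      rw [key.resolve_left hc, hj0, f1, zero_mul, mul_zero]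
    · obtain ⟨g', rfl⟩ := exists_bump_of_pos hpos
      obtain ⟨hg', hj'⟩ := le_two_of_bump hg
      have hj0 : g' j = 0 := by
        rw [bump_self] at hj
        omega
      have ih' := ih (∑ i, g' i) (by rw [← hn, sum_bump, sum_bump]; omega) g' rfl hg'
      have hb1 : bump g' j j = 1 := by rw [bump_self, hj0]
      rw [S.ket.C_node_bump S.hq S.hq4 S.hw hg' hj', dotProduct_smul, smul_eq_mul, ih',
        node_eq_of_eq_zero hj0, node_eq_of_eq_one hb1, ← f2 j,
        ← Finset.mul_prod_erase _ _ (Finset.mem_univ j), hj0, f0] at key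
      rw [node_eq_of_eq_one hb1] at hc
      rw [hb1, Finset.prod_congr rfl fun i hi => by rw [bump_of_ne g' (Finset.ne_of_mem_erase hi)]]
      apply mul_left_cancel₀ hc
      linear_combination -key

/-- It is enough to test on each height state at its N nodes. At heights 0 and 2 only components of
height 1 appear, and these vanish; at height 1 the terms from B and C cancel by `f2`. -/
theorem vecMul_eq_zero_of_dotProduct_K (S : HeightPair q w A B C D c e K L)
    (hn : Fintype.card n = 3 ^ N)
    {f : Fin N → ℕ → ℂ} (f0 : ∀ i, f i 0 = 1) (f1 : ∀ i, f i 1 = 0)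
    (f2 : ∀ i, c (w i) * f i 2 = e (q * w i)) {φ : n → ℂ}
    (hφ : ∀ h : Fin N → ℕ, (∀ i, h i ≤ 2) → φ ⬝ᵥ K h = (φ ⬝ᵥ K 0) * ∏ i, f i (h i))
    {z : ℂ} (hz : z ≠ 0) : φ ᵥ* (B z + C z) = 0 := by
  refine S.eq_zero_of_dotProduct_K hn fun h hh => ?_
  rw [vecMul_add_dotProduct]
  refine ((isTrig_dotProduct_mulVec S.trig_B φ (K h)).add
    (isTrig_dotProduct_mulVec S.trig_C φ (K h))).eq_zero_of_nodes
      (node_ne_zero S.hq S.hw h) (node_sq_ne S.hq S.hw hh) (fun j => ?_) hz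
  have vanish : ∀ g : Fin N → ℕ, (∀ i, g i ≤ 2) → g j = 1 → φ ⬝ᵥ K g = 0 := fun g hg hgj => by
    rw [hφ g hg, Finset.prod_eq_zero (Finset.mem_univ j) (by rw [hgj, f1]), mul_zero]
  rcases Nat.eq_zero_or_pos (h j) with hj0 | hpos
  · rw [S.ket.step h j (by omega), S.ket.C_node_of_eq_zero S.hq S.hq4 S.hw h hh j hj0,
      dotProduct_smul, vanish _ (bump_le_two hh (by omega)) (by rw [bump_self, hj0]),
      smul_zero, dotProduct_zero, add_zero]
  · obtain ⟨g, rfl⟩ := exists_bump_of_pos hpos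
    obtain ⟨hg, hj⟩ := le_two_of_bump hh
    rw [S.ket.C_node_bump S.hq S.hq4 S.hw hg hj, dotProduct_smul, smul_eq_mul]
    rcases Nat.eq_zero_or_pos (g j) with hj0 | hj1
    · have hb1 : bump g j j = 1 := by rw [bump_self, hj0]
      rw [S.ket.step _ j hb1.le, dotProduct_smul, smul_eq_mul, node_eq_of_eq_one hb1,
        node_eq_of_eq_zero hj0, hφ _ (bump_le_two hh hb1.le), hφ g hg, prod_bump, hb1,
        Finset.prod_congr rfl fun i hi => by rw [bump_of_ne g (Finset.ne_of_mem_erase hi)],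
        ← Finset.mul_prod_erase _ (fun i => f i (g i)) (Finset.mem_univ j), hj0, f0, ← f2 j]
      ring
    · rw [S.B_node_of_eq_two hn hh (by rw [bump_self]; omega), dotProduct_zero,
        vanish g hg (by omega)]
      ring

/-- The common left kernel of `B + C` is spanned by a covector with factorised components. -/
theorem exists_leftKernel (S : HeightPair q w A B C D c e K L) (hn : Fintype.card n = 3 ^ N)
    {f : Fin N → ℕ → ℂ} (f0 : ∀ i, f i 0 = 1) (f1 : ∀ i, f i 1 = 0)
    (f2 : ∀ i, c (w i) * f i 2 = e (q * w i)) :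
    ∃ ψ : n → ℂ, ψ ≠ 0 ∧
      (∀ φ : n → ℂ, (∀ z, z ≠ 0 → φ ᵥ* (B z + C z) = 0) ↔ ∃ a : ℂ, φ = a • ψ) ∧
      ∀ h : Fin N → ℕ, (∀ i, h i ≤ 2) → ψ ⬝ᵥ K h = ∏ i, f i (h i) := by
  obtain ⟨ψ, hψ⟩ : ∃ ψ : n → ℂ, ∀ h : Fin N → ℕ, (∀ i, h i ≤ 2) →
      ψ ⬝ᵥ K h = ∏ i, f i (h i) := by
    -- By biorthogonality, prescribed components are realised by dividing them by the norms.
    refine ⟨∑ h', ((∏ i, f i (natHeights h' i)) /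
      (L (natHeights h') ⬝ᵥ K (natHeights h'))) • L (natHeights h'), fun h hh => ?_⟩
    obtain ⟨h, rfl⟩ := exists_natHeights hh
    rw [S.dotProduct_sum, div_mul_cancel₀ _ (S.norm_ne_zero _ (natHeights_le h))]
  have hψ0 : ψ ⬝ᵥ K 0 = 1 := by simp [hψ 0 (by simp), f0]
  refine ⟨ψ, ?_, fun φ => ⟨fun hφ => ⟨φ ⬝ᵥ K 0, ?_⟩, ?_⟩, hψ⟩
  · rintro rfl
    simp at hψ0
  · rw [← sub_eq_zero]
    refine S.eq_zero_of_dotProduct_K hn fun h hh => ?_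
    rw [sub_dotProduct, smul_dotProduct, hψ h hh,
      S.dotProduct_K_of_vecMul_eq_zero f0 f1 f2 hφ h hh, smul_eq_mul, sub_self]
  · rintro ⟨a, rfl⟩ z hz
    rw [Matrix.smul_vecMul, S.vecMul_eq_zero_of_dotProduct_K hn f0 f1 f2 (fun h hh => ?_) hz,
      smul_zero]
    rw [hψ h hh, hψ0, one_mul]

/-- This is the resolution of the identity in the biorthogonal bases; it turns the overlap of the
null vectors into a sum over heights. -/
theorem dotProduct_eq_sum (S : HeightPair q w A B C D c e K L) (hn : Fintype.card n = 3 ^ N)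
    (x y : n → ℂ) :
    x ⬝ᵥ y = ∑ h : Fin N → Fin 3, (x ⬝ᵥ K (natHeights h)) * (L (natHeights h) ⬝ᵥ y) /
      (L (natHeights h) ⬝ᵥ K (natHeights h)) := by
  have hx : x = ∑ h, ((x ⬝ᵥ K (natHeights h)) / (L (natHeights h) ⬝ᵥ K (natHeights h))) •
      L (natHeights h) := by
    rw [← sub_eq_zero]
    refine S.eq_zero_of_dotProduct_K hn fun h hh => ?_
    obtain ⟨h, rfl⟩ := exists_natHeights hh
    rw [sub_dotProduct, S.dotProduct_sum, div_mul_cancel₀ _ (S.norm_ne_zero _ (natHeights_le h)),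
      sub_self]
  conv_lhs => rw [hx, sum_dotProduct]
  refine Finset.sum_congr rfl fun h _ => ?_
  rw [smul_dotProduct, smul_eq_mul]
  ring

end HeightPair

/-! ### The Yang–Baxter algebra -/

/-- The six-vertex `R`-matrix, with weights `[qx]`, `[x]`, `[q]`. -/
noncomputable def sixVertex (q x : ℂ) : Matrix (Fin 2 × Fin 2) (Fin 2 × Fin 2) ℂ :=
  Matrix.of fun p r =>
    if p = r then (if p.1 = p.2 then br (q * x) else br x)
    else if p = r.swap then br q else 0

section Exchange

section Ring

variable {𝓐 : Type*} [Ring 𝓐]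

/-- The product `M₁ M'₂` of two operator-valued matrices on different auxiliary spaces. -/
def mulLeftRight (M M' : Matrix (Fin 2) (Fin 2) 𝓐) : Matrix (Fin 2 × Fin 2) (Fin 2 × Fin 2) 𝓐 :=
  Matrix.of fun p r => M p.1 r.1 * M' p.2 r.2

/-- The product `M'₂ M₁` of two operator-valued matrices on different auxiliary spaces. -/
def mulRightLeft (M M' : Matrix (Fin 2) (Fin 2) 𝓐) : Matrix (Fin 2 × Fin 2) (Fin 2 × Fin 2) 𝓐 :=
  Matrix.of fun p r => M' p.2 r.2 * M p.1 r.1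

theorem mulLeftRight_mul {M M' P P' : Matrix (Fin 2) (Fin 2) 𝓐}
    (h : ∀ a b c d, Commute (P a b) (M' c d)) :
    mulLeftRight (M * P) (M' * P') = mulLeftRight M M' * mulLeftRight P P' := by
  ext p r
  simp only [mulLeftRight, Matrix.of_apply, Matrix.mul_apply, Fintype.sum_prod_type,
    Finset.sum_mul_sum]
  exact Finset.sum_congr rfl fun i _ => Finset.sum_congr rfl fun j _ =>
    (h _ _ _ _).mul_mul_mul_comm _ _

theorem mulRightLeft_mul {M M' P P' : Matrix (Fin 2) (Fin 2) 𝓐}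
    (h : ∀ a b c d, Commute (P' a b) (M c d)) :
    mulRightLeft (M * P) (M' * P') = mulRightLeft M M' * mulRightLeft P P' := by
  ext p r
  simp only [mulRightLeft, Matrix.of_apply, Matrix.mul_apply, Fintype.sum_prod_type,
    Finset.sum_mul_sum]
  rw [Finset.sum_comm]
  exact Finset.sum_congr rfl fun i _ => Finset.sum_congr rfl fun j _ =>
    (h _ _ _ _).mul_mul_mul_comm _ _

end Ring

variable {𝓐 : Type*} [Ring 𝓐] [Algebra ℂ 𝓐]

/-- The exchange relation `R₁₂(x) M₁ M'₂ = M'₂ M₁ R₁₂(x)`. -/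
def Exchange (q x : ℂ) (M M' : Matrix (Fin 2) (Fin 2) 𝓐) : Prop :=
  (sixVertex q x).map (algebraMap ℂ 𝓐) * mulLeftRight M M' =
    mulRightLeft M M' * (sixVertex q x).map (algebraMap ℂ 𝓐)

/-- Entries belonging to different sites commute, so a product over sites can be regrouped and the
scalar R-matrix passes through one site after the other. -/
theorem Exchange.mul {q x : ℂ} {M M' P P' : Matrix (Fin 2) (Fin 2) 𝓐} (hM : Exchange q x M M')
    (hP : Exchange q x P P') (h : ∀ a b c d, Commute (P a b) (M' c d))
    (h' : ∀ a b c d, Commute (P' a b) (M c d)) : Exchange q x (M * P) (M' * P') := by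
  unfold Exchange at *
  rw [mulLeftRight_mul h, mulRightLeft_mul h', ← mul_assoc, hM, mul_assoc, hP, mul_assoc]

theorem Exchange.one (q x : ℂ) : Exchange q x (1 : Matrix (Fin 2) (Fin 2) 𝓐) 1 := by
  have h1 : mulLeftRight (1 : Matrix (Fin 2) (Fin 2) 𝓐) 1 = 1 := by
    ext ⟨a, b⟩ ⟨c, d⟩
    simp [mulLeftRight, Matrix.one_apply, ← ite_and, and_comm]
  have h2 : mulRightLeft (1 : Matrix (Fin 2) (Fin 2) 𝓐) 1 = 1 := by
    ext ⟨a, b⟩ ⟨c, d⟩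
    simp [mulRightLeft, Matrix.one_apply, ← ite_and]
  rw [Exchange, h1, h2, mul_one, one_mul]

theorem Exchange.map {𝓑 : Type*} [Ring 𝓑] [Algebra ℂ 𝓑] (φ : 𝓐 →ₐ[ℂ] 𝓑) {q x : ℂ}
    {M M' : Matrix (Fin 2) (Fin 2) 𝓐} (h : Exchange q x M M') :
    Exchange q x (M.map φ) (M'.map φ) := by
  have hs : ((sixVertex q x).map (algebraMap ℂ 𝓐)).map φ =
      (sixVertex q x).map (algebraMap ℂ 𝓑) := by
    ext p r
    simp
  have h1 : (mulLeftRight M M').map φ = mulLeftRight (M.map φ) (M'.map φ) := by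
    ext p r
    simp [mulLeftRight]
  have h2 : (mulRightLeft M M').map φ = mulRightLeft (M.map φ) (M'.map φ) := by
    ext p r
    simp [mulRightLeft]
  have := congrArg (fun X => X.map φ) h
  simp only [Matrix.map_mul, hs, h1, h2] at this
  exact this

section Entries

variable {q x : ℂ} {M M' : Matrix (Fin 2) (Fin 2) 𝓐}

theorem Exchange.entry (h : Exchange q x M M') (p r : Fin 2 × Fin 2) :
    ∑ t, sixVertex q x p t • (M t.1 r.1 * M' t.2 r.2) =
      ∑ t, sixVertex q x t r • (M' p.2 t.2 * M p.1 t.1) := by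
  have := congrFun (congrFun h p) r
  simp only [Matrix.mul_apply, Matrix.map_apply, mulLeftRight, mulRightLeft, Matrix.of_apply,
    ← Algebra.smul_def, ← Algebra.commutes] at this
  exact this

theorem Exchange.BB (h : Exchange q x M M') :
    br (q * x) • (M 0 1 * M' 0 1) = br (q * x) • (M' 0 1 * M 0 1) := by
  simpa [sixVertex, Fintype.sum_prod_type] using h.entry (0, 0) (1, 1)

theorem Exchange.CC (h : Exchange q x M M') :
    br (q * x) • (M 1 0 * M' 1 0) = br (q * x) • (M' 1 0 * M 1 0) := by
  simpa [sixVertex, Fintype.sum_prod_type] using h.entry (1, 1) (0, 0)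

theorem Exchange.DB (h : Exchange q x M M') :
    br x • (M 1 1 * M' 0 1) = br (q * x) • (M' 0 1 * M 1 1) - br q • (M 0 1 * M' 1 1) := by
  rw [eq_sub_iff_add_eq, add_comm]
  simpa [sixVertex, Fintype.sum_prod_type] using h.entry (1, 0) (1, 1)

theorem Exchange.CD (h : Exchange q x M M') :
    br x • (M' 1 0 * M 1 1) = br (q * x) • (M 1 1 * M' 1 0) - br q • (M' 1 1 * M 1 0) := by
  rw [eq_sub_iff_add_eq, add_comm]
  simpa [sixVertex, Fintype.sum_prod_type] using (h.entry (1, 1) (1, 0)).symm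

theorem Exchange.CB (h : Exchange q x M M') :
    br x • (M 1 0 * M' 0 1 - M' 0 1 * M 1 0) = br q • (M' 0 0 * M 1 1 - M 0 0 * M' 1 1) := by
  have := h.entry (1, 0) (0, 1)
  simp [sixVertex, Fintype.sum_prod_type] at this
  rw [smul_sub, smul_sub, sub_eq_sub_iff_add_eq_add]
  rw [add_comm, this, add_comm]

theorem Exchange.CB' (h : Exchange q x M M') :
    br x • (M' 1 0 * M 0 1 - M 0 1 * M' 1 0) = br q • (M 1 1 * M' 0 0 - M' 1 1 * M 0 0) := by
  have := h.entry (0, 1) (1, 0)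
  simp [sixVertex, Fintype.sum_prod_type] at this
  rw [smul_sub, smul_sub, sub_eq_sub_iff_add_eq_add]
  rw [add_comm (br q • _), this, add_comm]

/-- At x = q⁻¹ the six-vertex matrix degenerates to a multiple of the antisymmetriser, so the
exchange relation equates two orderings of the quantum determinant. The second one is needed after
transposition. -/
theorem Exchange.det_symm (h : Exchange q q⁻¹ M M') (hq : br q ≠ 0) :
    M 0 0 * M' 1 1 - M 1 0 * M' 0 1 = M' 1 1 * M 0 0 - M' 1 0 * M 0 1 := by
  have := h.entry (0, 1) (0, 1)
  simp [sixVertex, Fintype.sum_prod_type, br_inv] at this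
  apply smul_right_injective 𝓐 hq
  simp only [smul_sub]
  rw [← sub_eq_zero] at this ⊢
  rw [← neg_eq_zero, ← this]
  abel

end Entries

/-- The quantum determinant of the pair `M`, `M'` is the scalar `δ`. -/
def QuantumDet (δ : ℂ) (M M' : Matrix (Fin 2) (Fin 2) 𝓐) : Prop :=
  ∀ a b, M 0 a * M' 1 b - M 1 a * M' 0 b =
    (δ * (!![0, 1; -1, 0] : Matrix (Fin 2) (Fin 2) ℂ) a b) • (1 : 𝓐)

theorem QuantumDet.one : QuantumDet 1 (1 : Matrix (Fin 2) (Fin 2) 𝓐) 1 := by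
  intro a b
  fin_cases a <;> fin_cases b <;> simp [Matrix.one_apply]

/-- Contracting `M` with `M'` leaves δ times the antisymmetric tensor, which is then contracted with
`P` and `P'`. This uses all four entries of the hypothesis, the reason for their presence in
`QuantumDet`. -/
theorem QuantumDet.mul {δ ε : ℂ} {M M' P P' : Matrix (Fin 2) (Fin 2) 𝓐} (hM : QuantumDet δ M M')
    (hP : QuantumDet ε P P') (h : ∀ a b c d, Commute (P a b) (M' c d)) :
    QuantumDet (δ * ε) (M * P) (M' * P') := by
  intro a b
  have e : ∀ c d, (M * P) c a * (M' * P') d b = ∑ i, ∑ j, (M c i * M' d j) * (P i a * P' j b) := by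
    intro c d
    simp only [Matrix.mul_apply, Finset.sum_mul_sum]
    exact Finset.sum_congr rfl fun i _ => Finset.sum_congr rfl fun j _ =>
      (h _ _ _ _).mul_mul_mul_comm _ _
  rw [e, e]
  simp only [← Finset.sum_sub_distrib, ← sub_mul, hM _ _]
  simp only [Fin.sum_univ_two]
  have := hP a b
  simp only [Matrix.of_apply, Matrix.cons_val', Matrix.cons_val_zero, Matrix.cons_val_one,
    Matrix.cons_val_fin_one, mul_zero, zero_smul, zero_mul, mul_one, mul_neg, neg_smul, neg_mul,
    zero_add, add_zero, smul_one_mul, ← sub_eq_add_neg, ← smul_sub, this, smul_smul, mul_assoc]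

theorem QuantumDet.map {𝓑 : Type*} [Ring 𝓑] [Algebra ℂ 𝓑] (φ : 𝓐 →ₐ[ℂ] 𝓑) {δ : ℂ}
    {M M' : Matrix (Fin 2) (Fin 2) 𝓐} (h : QuantumDet δ M M') :
    QuantumDet δ (M.map φ) (M'.map φ) := by
  intro a b
  have := congrArg φ (h a b)
  rw [map_smul, map_one] at this
  simpa using this

end Exchange

/-- The `R`-matrix of the ten-vertex model, as a matrix of operators on one site. -/
noncomputable def siteL (q s x : ℂ) : Matrix (Fin 2) (Fin 2) (Matrix (Fin 3) (Fin 3) ℂ) :=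
  Matrix.of fun α β => Matrix.of fun a b => R12 q s x (α, a) (β, b)

theorem siteL_zero_zero (q s x : ℂ) :
    siteL q s x 0 0 = !![br (q ^ 2 * x), 0, 0; 0, br (q * x), 0; 0, 0, br x] := by
  ext a b
  fin_cases a <;> fin_cases b <;> rfl

theorem siteL_zero_one (q s x : ℂ) : siteL q s x 0 1 = !![0, 0, 0; s, 0, 0; 0, s, 0] := by
  ext a b
  fin_cases a <;> fin_cases b <;> rfl

theorem siteL_one_zero (q s x : ℂ) : siteL q s x 1 0 = !![0, s, 0; 0, 0, s; 0, 0, 0] := by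
  ext a b
  fin_cases a <;> fin_cases b <;> rfl

theorem siteL_one_one (q s x : ℂ) :
    siteL q s x 1 1 = !![br x, 0, 0; 0, br (q * x), 0; 0, 0, br (q ^ 2 * x)] := by
  ext a b
  fin_cases a <;> fin_cases b <;> rfl

/-- A finite check, entry by entry; the value of s² balances the terms with two off-diagonal
weights. -/
theorem siteL_exchange {q s : ℂ} (hq : q ≠ 0) (hs : s ^ 2 = br q * br (q ^ 2)) {x y : ℂ}
    (hx : x ≠ 0) (hy : y ≠ 0) : Exchange q (x / y) (siteL q s x) (siteL q s y) := by
  have hs' : s * s = (q - q⁻¹) * (q ^ 2 - (q ^ 2)⁻¹) := by rw [← sq]; exact hs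
  unfold Exchange
  ext ⟨a, b⟩ ⟨c, d⟩ : 1
  rw [Matrix.mul_apply, Matrix.mul_apply]
  simp only [Fintype.sum_prod_type, Fin.sum_univ_two, mulLeftRight, mulRightLeft, Matrix.of_apply,
    Matrix.map_apply, ← Algebra.smul_def, ← Algebra.commutes]
  fin_cases a <;> fin_cases b <;> fin_cases c <;> fin_cases d <;>
    simp [sixVertex, siteL_zero_zero, siteL_zero_one, siteL_one_zero, siteL_one_one] <;>
    (try simp only [hs', br]) <;> and_intros <;>
    first
      | exact Or.inl (mul_comm _ _)
      | (ext i; fin_cases i <;> rfl)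
      | (field_simp; ring)

theorem siteL_quantumDet {q s : ℂ} (hq : q ≠ 0) (hs : s ^ 2 = br q * br (q ^ 2)) {x : ℂ}
    (hx : x ≠ 0) : QuantumDet (br (q ^ 2 * x) * br (q⁻¹ * x))
      (siteL q s (q⁻¹ * x)) (siteL q s x) := by
  have hs' : s * s = (q - q⁻¹) * (q ^ 2 - (q ^ 2)⁻¹) := by rw [← sq]; exact hs
  intro a b
  fin_cases a <;> fin_cases b <;>
    simp [siteL_zero_zero, siteL_zero_one, siteL_one_zero, siteL_one_one, Matrix.one_fin_three] <;>
    (try simp only [hs', br]) <;> and_intros <;>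
    first
      | (ext i; fin_cases i <;> rfl)
      | exact mul_comm _ _
      | (field_simp; ring1)
      | (ext i j; fin_cases i <;> fin_cases j <;> simp [field])

/-! ### The monodromy matrix -/

section Embedding

variable {N : ℕ}

/-- The operator that acts as `X` on the `j`-th factor of `(ℂ³)^{⊗N}`. -/
noncomputable def siteOp (j : Fin N) (X : Matrix (Fin 3) (Fin 3) ℂ) :
    Matrix (Conf N) (Conf N) ℂ :=
  Matrix.of fun σ τ => if ∀ k, k ≠ j → σ k = τ k then X (σ j) (τ j) else 0

theorem siteOp_apply_of_agree {j : Fin N} (X : Matrix (Fin 3) (Fin 3) ℂ) {σ τ : Conf N}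
    (h : ∀ k, k ≠ j → σ k = τ k) : siteOp j X σ τ = X (σ j) (τ j) := if_pos h

theorem siteOp_apply_of_not_agree {j : Fin N} (X : Matrix (Fin 3) (Fin 3) ℂ) {σ τ : Conf N}
    (h : ¬∀ k, k ≠ j → σ k = τ k) : siteOp j X σ τ = 0 := if_neg h

theorem siteOp_mulVec (j : Fin N) (X : Matrix (Fin 3) (Fin 3) ℂ) (v : Conf N → ℂ) (σ : Conf N) :
    (siteOp j X *ᵥ v) σ = ∑ a, X (σ j) a * v (Function.update σ j a) := by
  symm
  refine Finset.sum_of_injOn (fun a => Function.update σ j a)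
    (Function.update_injective σ j).injOn (by simp) ?_ ?_
  · intro τ _ hτ
    have : ¬∀ k, k ≠ j → σ k = τ k := by
      intro h
      refine hτ ⟨τ j, by simp, ?_⟩
      funext k
      by_cases hk : k = j
      · subst hk; simp
      · simp [hk, h k hk]
    beta_reduce
    rw [siteOp_apply_of_not_agree X this, zero_mul]
  · intro a _
    have : ∀ k, k ≠ j → σ k = Function.update σ j a k := fun k hk => by simp [hk]
    beta_reduce
    rw [siteOp_apply_of_agree X this, Function.update_self]

theorem siteOp_mul (j : Fin N) (X Y : Matrix (Fin 3) (Fin 3) ℂ) :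
    siteOp j (X * Y) = siteOp j X * siteOp j Y := by
  apply Matrix.ext_of_mulVec_single
  intro τ
  rw [← Matrix.mulVec_mulVec]
  funext σ
  simp only [siteOp_mulVec, Function.update_self, Function.update_idem, Matrix.mul_apply,
    Finset.sum_mul, Finset.mul_sum]
  rw [Finset.sum_comm]
  simp only [mul_assoc]

theorem siteOp_one (j : Fin N) : siteOp j 1 = (1 : Matrix (Conf N) (Conf N) ℂ) := by
  apply Matrix.ext_of_mulVec_single
  intro τ
  funext σ
  simp only [siteOp_mulVec, Matrix.one_apply, ite_mul, one_mul, zero_mul, Finset.sum_ite_eq,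
    Finset.mem_univ, if_true, Function.update_eq_self, Matrix.one_mulVec]

/-- The embedding of the operators on one site into the operators on `(ℂ³)^{⊗N}`. -/
noncomputable def siteHom (j : Fin N) :
    Matrix (Fin 3) (Fin 3) ℂ →ₐ[ℂ] Matrix (Conf N) (Conf N) ℂ :=
  AlgHom.ofLinearMap
    { toFun := siteOp j
      map_add' := fun X Y => by
        ext σ τ
        by_cases h : ∀ k, k ≠ j → σ k = τ k
        · simp [siteOp_apply_of_agree _ h]
        · simp [siteOp_apply_of_not_agree _ h]
      map_smul' := fun a X => by
        ext σ τ
        by_cases h : ∀ k, k ≠ j → σ k = τ k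
        · simp [siteOp_apply_of_agree _ h]
        · simp [siteOp_apply_of_not_agree _ h] }
    (siteOp_one j) (siteOp_mul j)

theorem siteHom_apply (j : Fin N) (X : Matrix (Fin 3) (Fin 3) ℂ) : siteHom j X = siteOp j X := rfl

theorem siteHom_commute {i j : Fin N} (hij : i ≠ j) (X Y : Matrix (Fin 3) (Fin 3) ℂ) :
    Commute (siteHom i X) (siteHom j Y) := by
  apply Matrix.ext_of_mulVec_single
  intro τ
  rw [← Matrix.mulVec_mulVec, ← Matrix.mulVec_mulVec]
  funext σ
  simp only [siteHom_apply, siteOp_mulVec, Finset.mul_sum, Function.update_of_ne hij,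
    Function.update_of_ne hij.symm]
  rw [Finset.sum_comm]
  refine Finset.sum_congr rfl fun a _ => Finset.sum_congr rfl fun b _ => ?_
  rw [Function.update_comm hij, mul_left_comm]

theorem siteHom_mulVec_allUp_of_col {j : Fin N} {X : Matrix (Fin 3) (Fin 3) ℂ} {x : ℂ}
    (h : ∀ a, X a 0 = if a = 0 then x else 0) : siteHom j X *ᵥ allUp N = x • allUp N := by
  funext σ
  rw [siteHom_apply, siteOp_mulVec, Finset.sum_eq_single 0]
  · rw [h, Pi.smul_apply, smul_eq_mul]
    by_cases hσ : σ j = 0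
    · rw [if_pos hσ, ← hσ, Function.update_eq_self]
    · rw [if_neg hσ, zero_mul, allUp, Pi.single_eq_of_ne, mul_zero]
      rintro rfl
      exact hσ rfl
  · intro a _ ha
    rw [allUp, Pi.single_eq_of_ne, mul_zero]
    intro e
    apply ha
    have := congrFun e j
    rwa [Function.update_self] at this
  · simp

theorem siteHom_transpose (j : Fin N) (X : Matrix (Fin 3) (Fin 3) ℂ) :
    (siteHom j X)ᵀ = siteHom j Xᵀ := by
  ext σ τ
  simp [siteHom_apply, siteOp, eq_comm]

end Embedding

/-! ### Operators on ℂ² ⊗ V as two-by-two block matrices -/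

section Blocks

variable {n : Type*}

/-- An operator on `ℂ² ⊗ V` as a two-by-two matrix of operators on `V`. -/
def blocks (X : Matrix (Fin 2 × n) (Fin 2 × n) ℂ) : Matrix (Fin 2) (Fin 2) (Matrix n n ℂ) :=
  Matrix.of fun α β => Matrix.of fun σ τ => X (α, σ) (β, τ)

theorem blocks_mul [Fintype n] (X Y : Matrix (Fin 2 × n) (Fin 2 × n) ℂ) :
    blocks (X * Y) = blocks X * blocks Y := by
  ext α β σ τ
  simp [blocks, Matrix.mul_apply, Fintype.sum_prod_type, Matrix.add_apply]

theorem blocks_one [DecidableEq n] : blocks (1 : Matrix (Fin 2 × n) (Fin 2 × n) ℂ) = 1 := by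
  ext α β σ τ
  by_cases h : α = β <;> simp [blocks, Matrix.one_apply, h]

theorem blocks_list_prod [Fintype n] [DecidableEq n] (l : List (Matrix (Fin 2 × n) (Fin 2 × n) ℂ)) :
    blocks l.prod = (l.map blocks).prod := by
  induction l with
  | nil => simp [blocks_one]
  | cons X l ih => simp [blocks_mul, ih]

end Blocks

/-! ### Exchange relation, quantum determinant and pseudo-vacuum for the monodromy matrix -/

section Monodromy

variable {N : ℕ} (q s : ℂ) (w : Fin N → ℂ)

/-- The factor of the monodromy matrix that belongs to the `j`-th site. -/
noncomputable def factor (j : Fin N) (z : ℂ) :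
    Matrix (Fin 2) (Fin 2) (Matrix (Conf N) (Conf N) ℂ) :=
  (siteL q s (q⁻¹ * z / w j)).map (siteHom j)

/-- The product of the factors of the monodromy matrix along a list of sites. -/
noncomputable def partialMonodromy (l : List (Fin N)) (z : ℂ) :
    Matrix (Fin 2) (Fin 2) (Matrix (Conf N) (Conf N) ℂ) :=
  (l.map fun j => factor q s w j z).prod

theorem blocks_monodromy (z : ℂ) :
    blocks (monodromy q s w z) = partialMonodromy q s w (List.finRange N).reverse z := by
  rw [monodromy, blocks_list_prod, partialMonodromy, List.ofFn_eq_map, List.map_reverse,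
    List.map_map, List.map_reverse]
  rfl

variable {q s w}

theorem partialMonodromy_cons (j : Fin N) (l : List (Fin N)) (z : ℂ) :
    partialMonodromy q s w (j :: l) z = factor q s w j z * partialMonodromy q s w l z := by
  simp [partialMonodromy]

theorem partialMonodromy_nil (z : ℂ) : partialMonodromy q s w [] z = 1 := by
  simp [partialMonodromy]

theorem partialMonodromy_commute {k : Fin N} {l : List (Fin N)} (hk : k ∉ l)
    (X : Matrix (Fin 3) (Fin 3) ℂ) (z : ℂ) (α β : Fin 2) :
    Commute (siteHom k X) (partialMonodromy q s w l z α β) := by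
  induction l generalizing α β with
  | nil =>
    rw [partialMonodromy_nil]
    by_cases h : α = β
    · rw [h, Matrix.one_apply_eq]; exact Commute.one_right _
    · rw [Matrix.one_apply_ne h]; exact Commute.zero_right _
  | cons j l ih =>
    rw [List.mem_cons, not_or] at hk
    rw [partialMonodromy_cons, Matrix.mul_apply]
    exact Commute.sum_right _ _ _ fun γ _ =>
      (siteHom_commute hk.1 _ _).mul_right (ih hk.2 _ _)

theorem factor_commute {k : Fin N} {l : List (Fin N)} (hk : k ∉ l) (z z' : ℂ)
    (α β γ δ : Fin 2) :
    Commute (factor q s w k z α β) (partialMonodromy q s w l z' γ δ) :=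
  partialMonodromy_commute hk _ _ _ _

theorem arg_ne_zero (hq : q ≠ 0) (hw : ∀ i, w i ≠ 0) (j : Fin N) {z : ℂ} (hz : z ≠ 0) :
    q⁻¹ * z / w j ≠ 0 :=
  div_ne_zero (mul_ne_zero (inv_ne_zero hq) hz) (hw j)

theorem partialMonodromy_exchange (hq : q ≠ 0) (hs : s ^ 2 = br q * br (q ^ 2))
    (hw : ∀ i, w i ≠ 0) {u v : ℂ} (hu : u ≠ 0) (hv : v ≠ 0) {l : List (Fin N)} (hl : l.Nodup) :
    Exchange q (u / v) (partialMonodromy q s w l u) (partialMonodromy q s w l v) := by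
  induction l with
  | nil => simpa only [partialMonodromy_nil] using Exchange.one q (u / v)
  | cons j l ih =>
    rw [List.nodup_cons] at hl
    rw [partialMonodromy_cons, partialMonodromy_cons]
    have h := (siteL_exchange hq hs (arg_ne_zero hq hw j hu)
      (arg_ne_zero hq hw j hv)).map (siteHom j)
    -- The inhomogeneity cancels in the ratio, so all sites share the same R-matrix.
    have e : q⁻¹ * u / w j / (q⁻¹ * v / w j) = u / v := by
      have := hw j
      field_simp
    rw [e] at h
    exact h.mul (ih hl.2) (fun _ _ _ _ => (factor_commute hl.1 _ _ _ _ _ _).symm)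
      (fun _ _ _ _ => (factor_commute hl.1 _ _ _ _ _ _).symm)

theorem partialMonodromy_quantumDet (hq : q ≠ 0) (hs : s ^ 2 = br q * br (q ^ 2))
    (hw : ∀ i, w i ≠ 0) {v : ℂ} (hv : v ≠ 0) {l : List (Fin N)} (hl : l.Nodup) :
    QuantumDet (l.map fun j => br (q * v / w j) * br (q⁻¹ * (q⁻¹ * v) / w j)).prod
      (partialMonodromy q s w l (q⁻¹ * v)) (partialMonodromy q s w l v) := by
  induction l with
  | nil => simpa only [partialMonodromy_nil, List.map_nil, List.prod_nil] using QuantumDet.one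
  | cons j l ih =>
    rw [List.nodup_cons] at hl
    rw [partialMonodromy_cons, partialMonodromy_cons, List.map_cons, List.prod_cons]
    have h := (siteL_quantumDet hq hs (arg_ne_zero hq hw j hv)).map (siteHom j)
    have e1 : q ^ 2 * (q⁻¹ * v / w j) = q * v / w j := by field_simp
    have e2 : q⁻¹ * (q⁻¹ * v / w j) = q⁻¹ * (q⁻¹ * v) / w j := by ring
    rw [e1, e2] at h
    exact h.mul (ih hl.2) fun _ _ _ _ => (factor_commute hl.1 _ _ _ _ _ _).symm

theorem factor_one_zero_mulVec (j : Fin N) (z : ℂ) : factor q s w j z 1 0 *ᵥ allUp N = 0 := by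
  rw [factor, Matrix.map_apply, siteL_one_zero, siteHom_mulVec_allUp_of_col (x := 0), zero_smul]
  intro a
  fin_cases a <;> rfl

theorem factor_one_one_mulVec (j : Fin N) (z : ℂ) :
    factor q s w j z 1 1 *ᵥ allUp N = br (q⁻¹ * z / w j) • allUp N := by
  rw [factor, Matrix.map_apply, siteL_one_one, siteHom_mulVec_allUp_of_col]
  intro a
  fin_cases a <;> rfl

theorem factor_zero_one_transpose_mulVec (j : Fin N) (z : ℂ) :
    (factor q s w j z 0 1)ᵀ *ᵥ allUp N = 0 := by
  rw [factor, Matrix.map_apply, siteL_zero_one, siteHom_transpose,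
    siteHom_mulVec_allUp_of_col (x := 0), zero_smul]
  intro a
  fin_cases a <;> rfl

theorem factor_one_one_transpose_mulVec (j : Fin N) (z : ℂ) :
    (factor q s w j z 1 1)ᵀ *ᵥ allUp N = br (q⁻¹ * z / w j) • allUp N := by
  rw [factor, Matrix.map_apply, siteL_one_one, siteHom_transpose, siteHom_mulVec_allUp_of_col]
  intro a
  fin_cases a <;> rfl

/-- The lower left entry at a single site annihilates ⇑, and it commutes with the operators of the
other sites, so it can be brought next to the vacuum. -/
theorem partialMonodromy_mulVec_allUp (z : ℂ) {l : List (Fin N)} (hl : l.Nodup) :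
    partialMonodromy q s w l z 1 0 *ᵥ allUp N = 0 ∧
    partialMonodromy q s w l z 1 1 *ᵥ allUp N =
      (l.map fun j => br (q⁻¹ * z / w j)).prod • allUp N := by
  induction l with
  | nil => simp [partialMonodromy_nil]
  | cons j l ih =>
    rw [List.nodup_cons] at hl
    obtain ⟨h0, h1⟩ := ih hl.2
    have key : ∀ α, factor q s w j z 1 0 *ᵥ (partialMonodromy q s w l z 0 α *ᵥ allUp N) = 0 := by
      intro α
      rw [Matrix.mulVec_mulVec, (factor_commute hl.1 _ _ _ _ _ _).eq,
        ← Matrix.mulVec_mulVec, factor_one_zero_mulVec, Matrix.mulVec_zero]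
    rw [partialMonodromy_cons]
    simp only [Matrix.mul_apply, Fin.sum_univ_two, Matrix.add_mulVec, ← Matrix.mulVec_mulVec, key,
      h0, h1, Matrix.mulVec_zero, Matrix.mulVec_smul, factor_one_one_mulVec, smul_smul, zero_add,
      List.map_cons, List.prod_cons, true_and]
    rw [mul_comm]

theorem partialMonodromy_transpose_mulVec_allUp (z : ℂ) {l : List (Fin N)} (hl : l.Nodup) :
    (partialMonodromy q s w l z 0 1)ᵀ *ᵥ allUp N = 0 ∧
    (partialMonodromy q s w l z 1 1)ᵀ *ᵥ allUp N =
      (l.map fun j => br (q⁻¹ * z / w j)).prod • allUp N := by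
  induction l with
  | nil => simp [partialMonodromy_nil]
  | cons j l ih =>
    rw [List.nodup_cons] at hl
    obtain ⟨h0, h1⟩ := ih hl.2
    have key : ∀ α, (partialMonodromy q s w l z α 1)ᵀ *ᵥ ((factor q s w j z 0 α)ᵀ *ᵥ allUp N) =
        (factor q s w j z 0 α)ᵀ *ᵥ ((partialMonodromy q s w l z α 1)ᵀ *ᵥ allUp N) := by
      intro α
      rw [Matrix.mulVec_mulVec, Matrix.mulVec_mulVec, ← Matrix.transpose_mul,
        ← Matrix.transpose_mul, (factor_commute hl.1 _ _ _ _ _ _).eq]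
    have key' : (partialMonodromy q s w l z 0 1)ᵀ *ᵥ ((factor q s w j z 1 0)ᵀ *ᵥ allUp N) = 0 := by
      rw [Matrix.mulVec_mulVec, ← Matrix.transpose_mul,
        (factor_commute hl.1 _ _ _ _ _ _).eq, Matrix.transpose_mul, ← Matrix.mulVec_mulVec,
        h0, Matrix.mulVec_zero]
    rw [partialMonodromy_cons]
    simp only [Matrix.mul_apply, Fin.sum_univ_two, Matrix.transpose_add, Matrix.transpose_mul,
      Matrix.add_mulVec, ← Matrix.mulVec_mulVec, key', factor_zero_one_transpose_mulVec,
      factor_one_one_transpose_mulVec, Matrix.mulVec_smul, h1, Matrix.mulVec_zero, smul_smul,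
      zero_add, add_zero, List.map_cons, List.prod_cons, and_true]
    rw [key, h0, Matrix.mulVec_zero]

end Monodromy

/-! ### Parity and degree of the monodromy entries -/

section Trig

variable {N : ℕ} {q s : ℂ} {w : Fin N → ℂ}

theorem isTrig_siteL (q s c : ℂ) (α β : Fin 2) (a b : Fin 3) :
    IsTrig (if α = β then 2 else 1) fun z => siteL q s (c * z) α β a b := by
  have h2 : IsTrig 2 fun z => br (q ^ 2 * (c * z)) :=
    (isTrig_br (q ^ 2 * c)).congr fun z _ => by rw [mul_assoc]
  have h1 : IsTrig 2 fun z => br (q * (c * z)) :=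
    (isTrig_br (q * c)).congr fun z _ => by rw [mul_assoc]
  have h0 : IsTrig 2 fun z => br (c * z) := isTrig_br c
  fin_cases α <;> fin_cases β <;> fin_cases a <;> fin_cases b <;>
    first
      | exact isTrig_zero _
      | exact isTrig_const s
      | exact h2
      | exact h1
      | exact h0

theorem isTrig_factor (j : Fin N) (α β : Fin 2) (σ τ : Conf N) :
    IsTrig (if α = β then 2 else 1) fun z => factor q s w j z α β σ τ := by
  by_cases h : ∀ k, k ≠ j → σ k = τ k
  · refine (isTrig_siteL q s (q⁻¹ / w j) α β (σ j) (τ j)).congr fun z _ => ?_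
    rw [factor, Matrix.map_apply, siteHom_apply, siteOp_apply_of_agree _ h, div_mul_eq_mul_div]
  · refine (isTrig_zero _).congr fun z _ => ?_
    rw [factor, Matrix.map_apply, siteHom_apply, siteOp_apply_of_not_agree _ h]

/-- Off-diagonal site weights are constant, so a change of the auxiliary spin costs one monomial.
Thus B and C have N monomials, as many as there are nodes. -/
theorem isTrig_partialMonodromy (l : List (Fin N)) (α β : Fin 2) (σ τ : Conf N) :
    IsTrig (if α = β then l.length + 1 else l.length)
      fun z => partialMonodromy q s w l z α β σ τ := by
  induction l generalizing α β σ τ with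
  | nil =>
    simp only [partialMonodromy_nil]
    by_cases h : α = β
    · simpa [h] using isTrig_const _
    · simpa [h] using isTrig_zero 0
  | cons j l ih =>
    have e : ∀ z, partialMonodromy q s w (j :: l) z α β σ τ =
        ∑ γ, ∑ ρ, factor q s w j z α γ σ ρ * partialMonodromy q s w l z γ β ρ τ := fun z => by
      rw [partialMonodromy_cons, Matrix.mul_apply, Matrix.sum_apply]
      simp only [Matrix.mul_apply]
    refine (IsTrig.sum _ fun γ _ => IsTrig.sum _ fun ρ _ => ?_).congr fun z _ => (e z).symm
    have hf := isTrig_factor (q := q) (s := s) (w := w) j α γ σ ρ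
    have hm := ih γ β ρ τ
    by_cases hαβ : α = β
    · subst hαβ
      by_cases hγ : α = γ
      · subst hγ
        rw [if_pos rfl] at hf hm ⊢
        exact hf.mul hm (by simp only [List.length_cons]; omega)
      · rw [if_neg hγ] at hf
        rw [if_neg (Ne.symm hγ)] at hm
        rw [if_pos rfl]
        -- Two spin flips cost two monomials, which keeps the parity of a diagonal entry.
        exact (hf.mul hm (by rw [add_comm])).add_two
    · rw [if_neg hαβ]
      by_cases hγ : α = γ
      · subst hγ
        rw [if_pos rfl] at hf
        rw [if_neg hαβ] at hm
        exact hf.mul hm (by simp only [List.length_cons]; omega)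
      · have hγβ : γ = β := by omega
        rw [if_neg hγ] at hf
        rw [if_pos hγβ] at hm
        exact hf.mul hm (by simp only [List.length_cons]; omega)

end Trig

/-! ### The height states of the ten-vertex model -/

section HeightProd

variable {N : ℕ} {M : Type*} [Monoid M]

/-- The product of the first `h_j` operators `X j 0, X j 1, …`, over all `j`. -/
def heightProd (X : Fin N → ℕ → M) (h : Fin N → ℕ) : M :=
  (List.ofFn fun j => ((List.range (h j)).map (X j)).prod).prod

theorem prod_ofFn_eq_mul {b : M} {f g : Fin N → M} {j : Fin N} (hj : g j = b * f j)
    (hne : ∀ i, i ≠ j → g i = f i) (hb : ∀ i, Commute b (f i)) :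
    (List.ofFn g).prod = b * (List.ofFn f).prod := by
  induction N with
  | zero => exact j.elim0
  | succ N ih =>
    rw [List.ofFn_succ, List.ofFn_succ, List.prod_cons, List.prod_cons]
    induction j using Fin.cases with
    | zero =>
      have : (fun i : Fin N => g i.succ) = fun i => f i.succ :=
        funext fun i => hne _ (Fin.succ_ne_zero i)
      rw [hj, this, mul_assoc]
    | succ j =>
      rw [ih (f := fun i => f i.succ) (j := j) hj
        (fun i hi => hne _ ((Fin.succ_injective _).ne hi)) fun i => hb _,
        hne _ (Fin.succ_ne_zero j).symm, (hb 0).symm.left_comm]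

theorem heightProd_bump (X : Fin N → ℕ → M) (hX : ∀ i j k l, Commute (X i k) (X j l))
    (h : Fin N → ℕ) (j : Fin N) : heightProd X (bump h j) = X j (h j) * heightProd X h := by
  have hc : ∀ i m, Commute (X j (h j)) ((List.range m).map (X i)).prod := fun i m =>
    Commute.list_prod_right _ _ fun y hy => by
      obtain ⟨k, _, rfl⟩ := List.mem_map.1 hy
      exact hX _ _ _ _
  refine prod_ofFn_eq_mul (j := j) ?_ (fun i hi => by rw [bump_of_ne _ hi]) fun i => hc _ _
  rw [bump_self, List.prod_range_succ, (hc _ _).eq]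

theorem heightProd_bump' (X : Fin N → ℕ → M) (hX : ∀ i j k l, Commute (X i k) (X j l))
    (h : Fin N → ℕ) (j : Fin N) : heightProd X (bump h j) = heightProd X h * X j (h j) := by
  rw [heightProd_bump X hX]
  refine Commute.list_prod_right _ _ fun y hy => ?_
  obtain ⟨i, rfl⟩ := List.mem_ofFn.1 hy
  refine Commute.list_prod_right _ _ fun y hy => ?_
  obtain ⟨k, _, rfl⟩ := List.mem_map.1 hy
  exact hX _ _ _ _

theorem heightProd_zero (X : Fin N → ℕ → M) : heightProd X 0 = 1 := by
  simp [heightProd]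

end HeightProd

section Concrete

variable {N : ℕ} (q s : ℂ) (w : Fin N → ℂ)

/-- The states `‖h⟩⟩`, for arbitrary heights. -/
noncomputable def ketState (h : Fin N → ℕ) : Conf N → ℂ :=
  heightProd (fun j l => (aFun q w (q ^ (1 - (l : ℤ)) * w j))⁻¹ •
    opB q s w (q ^ (1 - (l : ℤ)) * w j)) h *ᵥ allUp N

/-- The states `⟨⟨h‖`, for arbitrary heights. -/
noncomputable def braState (h : Fin N → ℕ) : Conf N → ℂ :=
  allUp N ᵥ* heightProd (fun j l => (dFun q w (q ^ (-(l : ℤ)) * w j))⁻¹ •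
    opC q s w (q ^ (1 - (l : ℤ)) * w j)) h

theorem transferAD_eq (z : ℂ) :
    transferAD q s w z = Complex.I • (opB q s w z + opC q s w z) := by
  ext σ τ
  simp [transferAD, trAux, Matrix.mul_apply, Fintype.sum_prod_type, twistAD, Matrix.one_apply,
    opB, opC]
  ring

variable {q s w}

/-- The factors are [q^m w_j/w_i] with m = 2 - h_j equal to 1 or 2; for i = j they are non-zero by
q⁴ ≠ 1, for i ≠ j by genericity. -/
theorem aFun_node_ne_zero (hq : q ≠ 0) (hq4 : q ^ 4 ≠ 1) (hw : GenericInhom q w) {h : Fin N → ℕ}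
    {j : Fin N} (hj : h j ≤ 1) : aFun q w (node q w h j) ≠ 0 := by
  refine Finset.prod_ne_zero_iff.2 fun i _ => ?_
  have hqz : q * node q w h j = q ^ (2 - (h j : ℤ)) * w j := by
    rw [node, ← mul_assoc, ← zpow_one_add₀ hq]
    congr 2; ring
  rw [hqz]
  by_cases hij : j = i
  · subst hij
    rw [mul_div_assoc, div_self (hw.1 j), mul_one]
    interval_cases h j
    · exact br_q_sq_ne_zero hq hq4
    · simpa using br_q_ne_zero hq hq4
  · refine hw.br_ne_zero hq hij ?_
    rw [abs_le]; constructor <;> omega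

theorem dFun_node_ne_zero (hq : q ≠ 0) (hq4 : q ^ 4 ≠ 1) (hw : GenericInhom q w) {h : Fin N → ℕ}
    {j : Fin N} (hj : h j ≤ 1) : dFun q w (q⁻¹ * node q w h j) ≠ 0 := by
  refine Finset.prod_ne_zero_iff.2 fun i _ => ?_
  have hqz : q⁻¹ * (q⁻¹ * node q w h j) = q ^ (-1 - (h j : ℤ)) * w j := by
    rw [node, ← mul_assoc, ← mul_assoc, ← zpow_neg_one, ← zpow_add₀ hq, ← zpow_add₀ hq]
    congr 2; ring
  rw [hqz]
  by_cases hij : j = i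
  · subst hij
    rw [mul_div_assoc, div_self (hw.1 j), mul_one]
    have : q ^ (-1 - (h j : ℤ)) = (q ^ (h j + 1))⁻¹ := by
      rw [← zpow_natCast, ← zpow_neg]
      congr 1; push_cast; ring
    rw [this, br_inv, neg_ne_zero]
    interval_cases h j
    · simpa using br_q_ne_zero hq hq4
    · exact br_q_sq_ne_zero hq hq4
  · refine hw.br_ne_zero hq hij ?_
    rw [abs_le]; constructor <;> omega

variable (q s w) in
/-- The monodromy matrix as a two-by-two matrix of operators. -/
noncomputable def monodromyBlocks (z : ℂ) : Matrix (Fin 2) (Fin 2) (Matrix (Conf N) (Conf N) ℂ) :=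
  blocks (monodromy q s w z)

theorem nodup_sites : (List.finRange N).reverse.Nodup :=
  List.nodup_reverse.2 (List.nodup_finRange N)

theorem prod_map_sites (f : Fin N → ℂ) : ((List.finRange N).reverse.map f).prod = ∏ i, f i := by
  rw [List.map_reverse, List.prod_reverse, ← List.ofFn_eq_map, List.prod_ofFn]

theorem monodromyBlocks_exchange (hq : q ≠ 0) (hs : s ^ 2 = br q * br (q ^ 2))
    (hw : ∀ i, w i ≠ 0) {u v : ℂ} (hu : u ≠ 0) (hv : v ≠ 0) :
    Exchange q (u / v) (monodromyBlocks q s w u) (monodromyBlocks q s w v) := by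
  rw [monodromyBlocks, monodromyBlocks, blocks_monodromy, blocks_monodromy]
  exact partialMonodromy_exchange hq hs hw hu hv nodup_sites

theorem monodromyBlocks_det (hq : q ≠ 0) (hs : s ^ 2 = br q * br (q ^ 2))
    (hw : ∀ i, w i ≠ 0) {v : ℂ} (hv : v ≠ 0) :
    monodromyBlocks q s w (q⁻¹ * v) 0 0 * monodromyBlocks q s w v 1 1 -
      monodromyBlocks q s w (q⁻¹ * v) 1 0 * monodromyBlocks q s w v 0 1 =
      (aFun q w v * dFun q w (q⁻¹ * v)) • 1 := by
  rw [monodromyBlocks, monodromyBlocks, blocks_monodromy, blocks_monodromy]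
  have := partialMonodromy_quantumDet hq hs hw hv (nodup_sites (N := N)) 0 1
  rw [prod_map_sites, Finset.prod_mul_distrib] at this
  simpa [aFun, dFun] using this

/-- The prefactors [qu/v] and [qv/u] cannot both vanish, since this would give q⁴ = 1; so the
relation can be cancelled in one of the two orders. -/
theorem commute_of_br {x : ℂ → Matrix (Conf N) (Conf N) ℂ} (hq : q ≠ 0) (hq4 : q ^ 4 ≠ 1)
    (h : ∀ u v, u ≠ 0 → v ≠ 0 → br (q * (u / v)) • (x u * x v) = br (q * (u / v)) • (x v * x u))
    {u v : ℂ} (hu : u ≠ 0) (hv : v ≠ 0) : Commute (x u) (x v) := by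
  by_cases h0 : br (q * (u / v)) = 0
  · have hne : br (q * (v / u)) ≠ 0 := ?_
    · exact (smul_right_injective _ hne (h v u hv hu)).symm
    intro h1
    rw [br_eq_zero_iff (mul_ne_zero hq (div_ne_zero hu hv))] at h0
    rw [br_eq_zero_iff (mul_ne_zero hq (div_ne_zero hv hu))] at h1
    apply hq4
    have : (q * (u / v)) ^ 2 * (q * (v / u)) ^ 2 = q ^ 4 := by field_simp
    rw [← this, h0, h1, one_mul]
  · exact smul_right_injective _ h0 (h u v hu hv)

theorem opB_commute (hq : q ≠ 0) (hq4 : q ^ 4 ≠ 1) (hs : s ^ 2 = br q * br (q ^ 2))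
    (hw : ∀ i, w i ≠ 0) {u v : ℂ} (hu : u ≠ 0) (hv : v ≠ 0) :
    Commute (opB q s w u) (opB q s w v) :=
  commute_of_br hq hq4 (fun _ _ hu hv => (monodromyBlocks_exchange hq hs hw hu hv).BB) hu hv

theorem opC_commute (hq : q ≠ 0) (hq4 : q ^ 4 ≠ 1) (hs : s ^ 2 = br q * br (q ^ 2))
    (hw : ∀ i, w i ≠ 0) {u v : ℂ} (hu : u ≠ 0) (hv : v ≠ 0) :
    Commute (opC q s w u) (opC q s w v) :=
  commute_of_br hq hq4 (fun _ _ hu hv => (monodromyBlocks_exchange hq hs hw hu hv).CC) hu hv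

theorem isTrig_opB (σ τ : Conf N) : IsTrig N fun z => opB q s w z σ τ := by
  have := isTrig_partialMonodromy (q := q) (s := s) (w := w) (List.finRange N).reverse 0 1 σ τ
  simp only [← blocks_monodromy] at this
  simpa [blocks, opB, opC] using this

theorem isTrig_opC (σ τ : Conf N) : IsTrig N fun z => opC q s w z σ τ := by
  have := isTrig_partialMonodromy (q := q) (s := s) (w := w) (List.finRange N).reverse 1 0 σ τ
  simp only [← blocks_monodromy] at this
  simpa [blocks, opB, opC] using this

theorem dFun_q_mul (hq : q ≠ 0) (hw : ∀ i, w i ≠ 0) (j : Fin N) : dFun q w (q * w j) = 0 := by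
  refine Finset.prod_eq_zero (Finset.mem_univ j) ?_
  rw [inv_mul_cancel_left₀ hq, div_self (hw j), br_one]

theorem ketState_zero : ketState q s w 0 = allUp N := by
  rw [ketState, heightProd_zero, Matrix.one_mulVec]

theorem braState_zero : braState q s w 0 = allUp N := by
  rw [braState, heightProd_zero, Matrix.vecMul_one]

theorem heightSystem_ket (hq : q ≠ 0) (hq4 : q ^ 4 ≠ 1) (hs : s ^ 2 = br q * br (q ^ 2))
    (hw : GenericInhom q w) :
    HeightSystem q w (fun z => monodromyBlocks q s w z 0 0) (opB q s w) (opC q s w)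
      (fun z => monodromyBlocks q s w z 1 1) (aFun q w) (fun z => dFun q w (q⁻¹ * z))
      (ketState q s w) where
  rel_DB u v hu hv := by
    rw [mul_div_assoc]; exact (monodromyBlocks_exchange hq hs hw.1 hu hv).DB
  rel_CB u v hu hv := (monodromyBlocks_exchange hq hs hw.1 hu hv).CB
  rel_det v hv := monodromyBlocks_det hq hs hw.1 hv
  D_vac j := by
    rw [ketState_zero, monodromyBlocks, blocks_monodromy,
      (partialMonodromy_mulVec_allUp _ nodup_sites).2, prod_map_sites]
    change dFun q w (q * w j) • _ = _
    rw [dFun_q_mul hq hw.1, zero_smul]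
  C_vac u _ := by
    rw [ketState_zero]
    have := (partialMonodromy_mulVec_allUp (q := q) (s := s) (w := w) u nodup_sites).1
    rwa [← blocks_monodromy] at this
  step h j hj := by
    have hb : ∀ (i j : Fin N) (k l : ℕ), Commute
        ((aFun q w (q ^ (1 - (k : ℤ)) * w i))⁻¹ • opB q s w (q ^ (1 - (k : ℤ)) * w i))
        ((aFun q w (q ^ (1 - (l : ℤ)) * w j))⁻¹ • opB q s w (q ^ (1 - (l : ℤ)) * w j)) :=
      fun i j k l => ((opB_commute hq hq4 hs hw.1 (mul_ne_zero (zpow_ne_zero _ hq) (hw.1 i))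
        (mul_ne_zero (zpow_ne_zero _ hq) (hw.1 j))).smul_left _).smul_right _
    rw [ketState, ketState, heightProd_bump _ hb, ← Matrix.mulVec_mulVec, Matrix.smul_mulVec]
    exact (smul_inv_smul₀ (aFun_node_ne_zero hq hq4 hw hj) _).symm
  c_ne h j hj := aFun_node_ne_zero hq hq4 hw hj

theorem heightSystem_bra (hq : q ≠ 0) (hq4 : q ^ 4 ≠ 1) (hs : s ^ 2 = br q * br (q ^ 2))
    (hw : GenericInhom q w) :
    HeightSystem q w (fun z => (monodromyBlocks q s w z 0 0)ᵀ) (fun z => (opC q s w z)ᵀ)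
      (fun z => (opB q s w z)ᵀ) (fun z => (monodromyBlocks q s w z 1 1)ᵀ)
      (fun z => dFun q w (q⁻¹ * z)) (aFun q w) (braState q s w) where
  rel_DB u v hu hv := by
    rw [mul_div_assoc]
    have h := congrArg Matrix.transpose (monodromyBlocks_exchange hq hs hw.1 hu hv).CD
    rw [Matrix.transpose_sub, Matrix.transpose_smul, Matrix.transpose_smul, Matrix.transpose_smul,
      Matrix.transpose_mul, Matrix.transpose_mul, Matrix.transpose_mul] at h
    exact h
  rel_CB u v hu hv := by
    have h := congrArg Matrix.transpose (monodromyBlocks_exchange hq hs hw.1 hu hv).CB'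
    rw [Matrix.transpose_smul, Matrix.transpose_smul, Matrix.transpose_sub, Matrix.transpose_sub,
      Matrix.transpose_mul, Matrix.transpose_mul, Matrix.transpose_mul, Matrix.transpose_mul] at h
    exact h
  rel_det v hv := by
    have h := monodromyBlocks_exchange hq hs hw.1 (mul_ne_zero (inv_ne_zero hq) hv) hv
    rw [mul_div_assoc, div_self hv, mul_one] at h
    -- Transposition reverses products, so the other ordering of the determinant is the one required
    -- here.
    have h2 := (h.det_symm (br_q_ne_zero hq hq4)).symm.trans (monodromyBlocks_det hq hs hw.1 hv)
    have h3 := congrArg Matrix.transpose h2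
    rw [Matrix.transpose_sub, Matrix.transpose_mul, Matrix.transpose_mul, Matrix.transpose_smul,
      Matrix.transpose_one, mul_comm (aFun q w v)] at h3
    exact h3
  D_vac j := by
    rw [braState_zero, monodromyBlocks, blocks_monodromy,
      (partialMonodromy_transpose_mulVec_allUp _ nodup_sites).2, prod_map_sites]
    change dFun q w (q * w j) • _ = _
    rw [dFun_q_mul hq hw.1, zero_smul]
  C_vac u _ := by
    rw [braState_zero]
    have := (partialMonodromy_transpose_mulVec_allUp (q := q) (s := s) (w := w) u nodup_sites).1
    rwa [← blocks_monodromy] at this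
  step h j hj := by
    have hb : ∀ (i j : Fin N) (k l : ℕ), Commute
        ((dFun q w (q ^ (-(k : ℤ)) * w i))⁻¹ • opC q s w (q ^ (1 - (k : ℤ)) * w i))
        ((dFun q w (q ^ (-(l : ℤ)) * w j))⁻¹ • opC q s w (q ^ (1 - (l : ℤ)) * w j)) :=
      fun i j k l => ((opC_commute hq hq4 hs hw.1 (mul_ne_zero (zpow_ne_zero _ hq) (hw.1 i))
        (mul_ne_zero (zpow_ne_zero _ hq) (hw.1 j))).smul_left _).smul_right _
    have e : q⁻¹ * node q w h j = q ^ (-(h j : ℤ)) * w j := by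
      rw [node, ← mul_assoc, ← zpow_neg_one, ← zpow_add₀ hq]
      congr 2; ring
    have hd := dFun_node_ne_zero hq hq4 hw hj
    rw [braState, braState, heightProd_bump' _ hb, ← Matrix.vecMul_vecMul, Matrix.vecMul_smul, e,
      Matrix.mulVec_transpose]
    rw [e] at hd
    exact (smul_inv_smul₀ hd _).symm
  c_ne h j hj := dFun_node_ne_zero hq hq4 hw hj

theorem heightPair (hq : q ≠ 0) (hq4 : q ^ 4 ≠ 1) (hs : s ^ 2 = br q * br (q ^ 2))
    (hw : GenericInhom q w) :
    HeightPair q w (fun z => monodromyBlocks q s w z 0 0) (opB q s w) (opC q s w)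
      (fun z => monodromyBlocks q s w z 1 1) (aFun q w) (fun z => dFun q w (q⁻¹ * z))
      (ketState q s w) (braState q s w) where
  hq := hq
  hq4 := hq4
  hw := hw
  ket := heightSystem_ket hq hq4 hs hw
  bra := heightSystem_bra hq hq4 hs hw
  trig_B := isTrig_opB
  trig_C := isTrig_opC
  vac := by
    rw [ketState_zero, braState_zero, allUp]
    simp

end Concrete

/-! ### Norms of the height states and the overlap of the two eigenvectors -/

section Cut

variable {ι : Type*}

/-- Each ordered pair cancels against its swap. -/
theorem prod_prod_eq_one (F : ι → ι → ℂ) (I : Finset ι)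
    (h : ∀ i j, i ∈ I → j ∈ I → F i j * F j i = 1)
    (h1 : ∀ i ∈ I, F i i = 1) : ∏ i ∈ I, ∏ j ∈ I, F i j = 1 := by
  rw [← Finset.prod_product' I I F]
  refine Finset.prod_involution (fun p _ => p.swap) ?_ ?_ ?_ ?_
  · rintro ⟨i, j⟩ hp
    rw [Finset.mem_product] at hp
    exact h i j hp.1 hp.2
  · rintro ⟨i, j⟩ hp hF e
    obtain rfl : j = i := congrArg Prod.fst e
    exact hF (h1 j (Finset.mem_product.1 hp).1)
  · rintro ⟨i, j⟩ hp
    rw [Finset.mem_product] at hp ⊢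
    exact hp.symm
  · rintro ⟨i, j⟩ _
    rfl

variable [Fintype ι] [DecidableEq ι]

/-- The product of `g i k` over the ordered pairs that are cut by `I`. -/
def cutProd (g : ι → ι → ℂ) (I : Finset ι) : ℂ := ∏ i ∈ I, ∏ k ∈ Iᶜ, g i k

/-- Moving j into I loses the pairs (i, j) and gains the pairs (j, k); the form without division
needs no non-vanishing. -/
theorem cutProd_insert (g : ι → ι → ℂ) {I : Finset ι} {j : ι} (hj : j ∉ I) :
    cutProd g (insert j I) * ∏ i ∈ I, g i j = cutProd g I * ∏ k ∈ Iᶜ.erase j, g j k := by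
  have hc : (insert j I)ᶜ = Iᶜ.erase j := by ext; simp
  have h1 : cutProd g I = ∏ i ∈ I, (g i j * ∏ k ∈ Iᶜ.erase j, g i k) :=
    Finset.prod_congr rfl fun i _ =>
      (Finset.mul_prod_erase _ _ (Finset.mem_compl.2 hj)).symm
  rw [h1, Finset.prod_mul_distrib, cutProd, Finset.prod_insert hj, hc]
  ring

theorem cutProd_eq_prod_offDiag (g : ι → ι → ℂ) (I : Finset ι) :
    cutProd g I = ∏ p ∈ (Finset.univ : Finset ι).offDiag,
      if p.1 ∈ I ∧ p.2 ∉ I then g p.1 p.2 else 1 := by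
  rw [← Finset.prod_filter, cutProd, ← Finset.prod_product']
  refine Finset.prod_congr ?_ fun _ _ => rfl
  ext ⟨i, k⟩
  simp only [Finset.mem_product, Finset.mem_compl, Finset.mem_filter, Finset.mem_offDiag,
    Finset.mem_univ, true_and]
  exact ⟨fun h => ⟨fun e => h.2 (e ▸ h.1), h⟩, fun h => h.2⟩

theorem prod_prod_eq_cutProd (F : ι → ι → ℂ) (I : Finset ι)
    (h : ∀ i j, i ∈ I → j ∈ I → F i j * F j i = 1) (h1 : ∀ i ∈ I, F i i = 1) :
    ∏ i ∈ I, ∏ j, F i j = cutProd F I := by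
  have : ∀ i, ∏ j, F i j = (∏ j ∈ I, F i j) * ∏ j ∈ Iᶜ, F i j := fun i =>
    (Finset.prod_mul_prod_compl I _).symm
  rw [Finset.prod_congr rfl fun i _ => this i, Finset.prod_mul_distrib, prod_prod_eq_one F I h h1,
    one_mul, cutProd]

end Cut

/-! ### Norms of the states with heights 0 and 2 -/

section Overlap

variable {N : ℕ} {n : Type*} [Fintype n] [DecidableEq n] {q : ℂ} {w : Fin N → ℂ}
  {A B C D : ℂ → Matrix n n ℂ} {c e : ℂ → ℂ} {K L : (Fin N → ℕ) → n → ℂ}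

/-- The heights that are `2` on `I` and `0` elsewhere. -/
def extremeHeights (I : Finset (Fin N)) : Fin N → Fin 3 := fun i => if i ∈ I then 2 else 0

theorem natHeights_extreme (I : Finset (Fin N)) (i : Fin N) :
    natHeights (extremeHeights I) i = if i ∈ I then 2 else 0 := by
  by_cases h : i ∈ I <;> simp [natHeights, extremeHeights, h]

theorem natHeights_extreme_insert {I : Finset (Fin N)} {j : Fin N} (hj : j ∉ I) :
    natHeights (extremeHeights (insert j I)) =
      bump (bump (natHeights (extremeHeights I)) j) j := by
  funext i
  by_cases hi : i = j
  · subst hi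
    rw [bump_self, bump_self, natHeights_extreme, natHeights_extreme]
    simp [hj]
  · rw [bump_of_ne _ hi, bump_of_ne _ hi, natHeights_extreme, natHeights_extreme]
    simp [hi]

theorem GenericInhom.br_div_ne (hq : q ≠ 0) (hw : GenericInhom q w) {i j : Fin N} (hij : i ≠ j) :
    br (w i / w j) ≠ 0 := by
  simpa using hw.br_ne_zero hq hij (m := 0) (by norm_num)

theorem br_inv_div (a x y : ℂ) : br (a⁻¹ * x / y) = -br (a * y / x) := by
  rw [← br_inv, inv_div, mul_comm a y, ← div_div, div_div, mul_comm y a, ← div_div]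
  congr 1
  ring

/-- Sites are added to I one at a time, each by two uses of `norm_bump`; the result is matched with
`cutProd_insert`. -/
theorem HeightPair.norm_extreme (S : HeightPair q w A B C D c e K L) (I : Finset (Fin N)) :
    L (natHeights (extremeHeights I)) ⬝ᵥ K (natHeights (extremeHeights I)) =
      cutProd (fun i k => br (w i / w k) / br ((q ^ 2)⁻¹ * w i / w k)) I := by
  have hq := S.hq
  have h2 : ∀ i k, i ≠ k → br ((q ^ 2)⁻¹ * w i / w k) ≠ 0 := fun i k hik => by
    have := S.hw.br_ne_zero S.hq hik (m := -2) (by norm_num)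
    rwa [zpow_neg] at this
  induction I using Finset.induction_on with
  | empty =>
    have : natHeights (extremeHeights (∅ : Finset (Fin N))) = 0 := by
      funext i; rw [natHeights_extreme]; simp
    rw [this, S.vac]
    simp [cutProd]
  | insert j I hj ih =>
    set g := natHeights (extremeHeights I) with hg
    have hgj : g j = 0 := by rw [hg, natHeights_extreme, if_neg hj]
    have hg2 : ∀ i, g i ≤ 2 := natHeights_le _
    have hb2 : ∀ i, bump g j i ≤ 2 := bump_le_two hg2 (by omega)
    have n1 := S.norm_bump hg2 (j := j) (by omega)
    have n2 := S.norm_bump hb2 (j := j) (by rw [bump_self]; omega)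
    have e1 : ∀ z, ∏ k ∈ Finset.univ.erase j, br (z / node q w (bump g j) k) =
        ∏ k ∈ Finset.univ.erase j, br (z / node q w g k) := fun z =>
      Finset.prod_congr rfl fun k hk => by rw [node_bump_of_ne _ (Finset.ne_of_mem_erase hk)]
    rw [e1, e1, node_bump_self hq] at n2
    have hne : ∏ k ∈ Finset.univ.erase j, br (q⁻¹ * node q w g j / node q w g k) ≠ 0 := by
      refine Finset.prod_ne_zero_iff.2 fun k hk => ?_
      have hk := Finset.ne_of_mem_erase hk
      rw [← node_bump_self hq, ← node_bump_of_ne g hk]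
      exact br_div_ne_zero (node_ne_zero hq S.hw _ _) (node_ne_zero hq S.hw _ _)
        (node_sq_ne hq S.hw hb2 _ _ hk.symm)
    have split : ∀ F : Fin N → ℂ, ∏ k ∈ Finset.univ.erase j, F k =
        (∏ k ∈ I, F k) * ∏ k ∈ Iᶜ.erase j, F k := fun F => by
      rw [← Finset.prod_union]
      · congr 1
        ext k
        by_cases hk : k ∈ I <;> simp [hk]
        rintro rfl; exact hj hk
      · rw [Finset.disjoint_left]
        intro k hk hk'
        simp [hk] at hk'
    have hin : ∀ k ∈ I, node q w g k = q⁻¹ * w k := fun k hk => by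
      have : g k = 2 := by rw [hg, natHeights_extreme, if_pos hk]
      rw [node, this]
      norm_num
    have hout : ∀ k ∈ Iᶜ.erase j, node q w g k = q * w k := fun k hk => by
      have : g k = 0 := by
        rw [hg, natHeights_extreme, if_neg (Finset.mem_compl.1 (Finset.mem_of_mem_erase hk))]
      rw [node, this]
      norm_num
    have key : (L (bump (bump g j) j) ⬝ᵥ K (bump (bump g j) j)) *
        ((∏ k ∈ I, br (w j / w k)) * ∏ k ∈ Iᶜ.erase j, br ((q ^ 2)⁻¹ * w j / w k)) =
        (L g ⬝ᵥ K g) *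
          ((∏ k ∈ I, br (q ^ 2 * w j / w k)) * ∏ k ∈ Iᶜ.erase j, br (w j / w k)) := by
      have f1 : ∏ k ∈ Finset.univ.erase j, br (q⁻¹ * (q⁻¹ * node q w g j) / node q w g k) =
          (∏ k ∈ I, br (w j / w k)) * ∏ k ∈ Iᶜ.erase j, br ((q ^ 2)⁻¹ * w j / w k) := by
        rw [split, node_eq_of_eq_zero hgj]
        congr 1
        · refine Finset.prod_congr rfl fun k hk => ?_
          rw [hin k hk]; congr 1; field_simp
        · refine Finset.prod_congr rfl fun k hk => ?_
          rw [hout k hk]; congr 1; field_simp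
      have f2 : ∏ k ∈ Finset.univ.erase j, br (node q w g j / node q w g k) =
          (∏ k ∈ I, br (q ^ 2 * w j / w k)) * ∏ k ∈ Iᶜ.erase j, br (w j / w k) := by
        rw [split, node_eq_of_eq_zero hgj]
        congr 1
        · refine Finset.prod_congr rfl fun k hk => ?_
          rw [hin k hk]; congr 1; field_simp
        · refine Finset.prod_congr rfl fun k hk => ?_
          rw [hout k hk]; congr 1; field_simp
      -- The intermediate product is common to both recursions and drops out, and the two signs
      -- cancel.
      rw [← f1, ← f2, n2]
      linear_combination -n1
    rw [natHeights_extreme_insert hj, ← hg]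
    have hjI : ∀ k ∈ I, k ≠ j := fun k hk e => hj (e ▸ hk)
    have hjO : ∀ k ∈ Iᶜ.erase j, j ≠ k := fun k hk => (Finset.ne_of_mem_erase hk).symm
    have ci := cutProd_insert (fun i k => br (w i / w k) / br ((q ^ 2)⁻¹ * w i / w k)) hj
    have p1 : ∏ k ∈ I, br (w j / w k) ≠ 0 :=
      Finset.prod_ne_zero_iff.2 fun k hk => S.hw.br_div_ne hq (hjI k hk).symm
    have p2 : ∏ k ∈ Iᶜ.erase j, br ((q ^ 2)⁻¹ * w j / w k) ≠ 0 :=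
      Finset.prod_ne_zero_iff.2 fun k hk => h2 _ _ (hjO k hk)
    have p3 : ∏ k ∈ I, br (q ^ 2 * w j / w k) ≠ 0 :=
      Finset.prod_ne_zero_iff.2 fun k hk => by
        have := S.hw.br_ne_zero hq (hjI k hk).symm (m := 2) (by norm_num)
        exact_mod_cast this
    have hI : ∏ i ∈ I, br (w i / w j) / br ((q ^ 2)⁻¹ * w i / w j) =
        (∏ k ∈ I, br (w j / w k)) / ∏ k ∈ I, br (q ^ 2 * w j / w k) := by
      rw [← Finset.prod_div_distrib]
      refine Finset.prod_congr rfl fun k _ => ?_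
      rw [br_inv_div, ← inv_div (w j), br_inv, neg_div_neg_eq]
    rw [hI, Finset.prod_div_distrib, ← ih] at ci
    rw [mul_div_assoc', mul_div_assoc', div_eq_div_iff p3 p2] at ci
    apply mul_left_cancel₀ (mul_ne_zero p1 p2)
    linear_combination key - ci

end Overlap

/-! ### Commuting families -/

section Commuting

open Module

/-- A commuting family has a joint eigenvector in every non-zero invariant subspace. -/
theorem exists_joint_eigenvector {ι V : Type*} [AddCommGroup V] [Module ℂ V]
    [FiniteDimensional ℂ V] {f : ι → End ℂ V} (hf : ∀ i j, Commute (f i) (f j))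
    {K : Submodule ℂ V} (hK : K ≠ ⊥) (hinv : ∀ i, ∀ v ∈ K, f i v ∈ K) :
    ∃ v ∈ K, v ≠ 0 ∧ ∃ χ : ι → ℂ, ∀ i, f i v = χ i • v := by
  -- On a minimal non-zero invariant subspace every operator is scalar: by commutation each of its
  -- eigenspaces is again invariant.
  obtain ⟨U, ⟨hU0, hUK, hU⟩, hmin⟩ := wellFounded_lt.has_min
    {U : Submodule ℂ V | U ≠ ⊥ ∧ U ≤ K ∧ ∀ i, ∀ v ∈ U, f i v ∈ U} ⟨K, hK, le_rfl, hinv⟩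
  have scalar : ∀ i, ∃ μ : ℂ, ∀ v ∈ U, f i v = μ • v := by
    intro i
    have := Submodule.nontrivial_iff_ne_bot.2 hU0
    obtain ⟨μ, hμ⟩ := End.exists_eigenvalue ((f i).restrict (hU i))
    obtain ⟨x, hx⟩ := hμ.exists_hasEigenvector
    refine ⟨μ, fun v hv => ?_⟩
    by_contra hne
    refine hmin (U ⊓ (f i).eigenspace μ) ⟨?_, inf_le_left.trans hUK, ?_⟩ ?_
    · refine (Submodule.ne_bot_iff _).2 ⟨x, ⟨x.2, ?_⟩, fun h => hx.2 (Subtype.ext h)⟩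
      exact End.mem_eigenspace_iff.2 (congrArg Subtype.val hx.apply_eq_smul)
    · rintro j y ⟨hy, hy'⟩
      refine ⟨hU j y hy, End.mem_eigenspace_iff.2 ?_⟩
      have h1 := LinearMap.congr_fun (hf i j).eq y
      rw [End.mul_apply, End.mul_apply, End.mem_eigenspace_iff.1 hy', map_smul] at h1
      exact h1
    · exact lt_of_le_of_ne inf_le_left fun e =>
        hne (End.mem_eigenspace_iff.1 ((inf_eq_left.1 e) hv))
  choose χ hχ using scalar
  obtain ⟨v, hv, hv0⟩ := (Submodule.ne_bot_iff _).1 hU0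
  exact ⟨v, hUK hv, hv0, χ, fun i => hχ i v hv⟩

/-- A commuting family has finitely many joint eigenvalues. -/
theorem finite_joint_eigenvalues {ι V : Type*} [AddCommGroup V] [Module ℂ V]
    [FiniteDimensional ℂ V] {f : ι → End ℂ V} (hf : ∀ i j, Commute (f i) (f j)) :
    {χ : ι → ℂ | ∃ v, v ≠ 0 ∧ ∀ i, f i v = χ i • v}.Finite := by
  -- The joint generalised eigenspaces are independent, so finite dimension allows only finitely
  -- many non-zero ones.
  have hind := End.independent_iInf_maxGenEigenspace_of_forall_mapsTo f
    fun i j φ => End.mapsTo_maxGenEigenspace_of_comm (hf j i) φ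
  refine (WellFoundedGT.finite_ne_bot_of_iSupIndep hind).subset ?_
  rintro χ ⟨v, hv0, hv⟩
  refine (Submodule.ne_bot_iff _).2 ⟨v, ?_, hv0⟩
  rw [End.mem_iInf_maxGenEigenspace_iff]
  intro i
  exact ⟨1, by simp [hv i]⟩

/-- Suppose that commuting matrices `T z`, trigonometric in `z`, have a common left and a common
right null vector with non-zero overlap, and that the latter spans the common kernel.  Then `0` is
a simple eigenvalue of `T z` for all but finitely many `z`. -/
theorem finite_rootMultiplicity_ne_one {n : Type*} [Fintype n] [DecidableEq n] {N : ℕ}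
    {T : ℂ → Matrix n n ℂ} (htrig : ∀ σ τ, IsTrig N fun z => T z σ τ)
    (hcomm : ∀ u v, u ≠ 0 → v ≠ 0 → Commute (T u) (T v)) {φ ψ : n → ℂ}
    (hφ : ∀ z, z ≠ 0 → φ ᵥ* T z = 0)
    (hψ : ∀ v : n → ℂ, (∀ z, z ≠ 0 → T z *ᵥ v = 0) ↔ ∃ c : ℂ, v = c • ψ)
    (hover : φ ⬝ᵥ ψ ≠ 0) :
    {z : ℂ | z ≠ 0 ∧ (T z).charpoly.rootMultiplicity 0 ≠ 1}.Finite := by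
  classical
  let f : {z : ℂ // z ≠ 0} → End ℂ (n → ℂ) := fun z => Matrix.toLin' (T z)
  have hf : ∀ i j, Commute (f i) (f j) := fun i j => by
    rw [Commute, SemiconjBy, End.mul_eq_comp, End.mul_eq_comp, ← Matrix.toLin'_mul,
      ← Matrix.toLin'_mul, (hcomm i j i.2 j.2).eq]
  have hfa : ∀ i v, f i v = T i *ᵥ v := fun i v => Matrix.toLin'_apply _ _
  -- The hyperplane annihilated by the left null vector contains the range of every T(z), and by
  -- `hover` it does not contain ψ.
  let W : Submodule ℂ (n → ℂ) :=
    { carrier := {v | φ ⬝ᵥ v = 0}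
      add_mem' := fun {a b} (ha : φ ⬝ᵥ a = 0) (hb : φ ⬝ᵥ b = 0) => by
        change φ ⬝ᵥ (a + b) = 0
        rw [dotProduct_add, ha, hb, add_zero]
      zero_mem' := dotProduct_zero φ
      smul_mem' := fun c a (ha : φ ⬝ᵥ a = 0) => by
        change φ ⬝ᵥ (c • a) = 0
        rw [dotProduct_smul, ha, smul_zero] }
  have hW : ∀ v, v ∈ W ↔ φ ⬝ᵥ v = 0 := fun v => Iff.rfl
  have hTW : ∀ i v, f i v ∈ W := fun i v => by
    rw [hW, hfa, Matrix.dotProduct_mulVec, hφ i i.2, zero_dotProduct]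
  have hTψ : ∀ i, f i ψ = 0 := fun i => by
    rw [hfa]; exact (hψ ψ).2 ⟨1, (one_smul _ _).symm⟩ i i.2
  let X : Set ({z : ℂ // z ≠ 0} → ℂ) := {χ | ∃ v ∈ W, v ≠ 0 ∧ ∀ i, f i v = χ i • v}
  have hX : X.Finite := (finite_joint_eigenvalues hf).subset
    fun χ ⟨v, _, h⟩ => ⟨v, h⟩
  have hzeros : ∀ χ ∈ X, {z : ℂ | ∃ h : z ≠ 0, χ ⟨z, h⟩ = 0}.Finite := by
    rintro χ ⟨v, hvW, hv0, hv⟩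
    obtain ⟨σ, hσ⟩ := Function.ne_iff.1 hv0
    rw [Pi.zero_apply] at hσ
    have ht : IsTrig N fun z => Pi.single σ 1 ⬝ᵥ (T z *ᵥ v) :=
      isTrig_dotProduct_mulVec htrig _ _
    have hval : ∀ z (h : z ≠ 0), Pi.single σ 1 ⬝ᵥ (T z *ᵥ v) = χ ⟨z, h⟩ * v σ := fun z h => by
      rw [← hfa ⟨z, h⟩, hv]; simp
    -- An identically vanishing eigenvalue would place its eigenvector in the common kernel, hence
    -- make it a multiple of ψ inside `W`.
    have hex : ∃ z, ∃ h : z ≠ 0, χ ⟨z, h⟩ ≠ 0 := by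
      by_contra hc
      push Not at hc
      obtain ⟨c, rfl⟩ := (hψ v).1 fun z h => by rw [← hfa ⟨z, h⟩, hv, hc z h, zero_smul]
      rw [hW, dotProduct_smul, smul_eq_mul, mul_eq_zero] at hvW
      rw [hvW.resolve_right hover, zero_smul] at hv0
      exact hv0 rfl
    obtain ⟨z₀, h₀, hne⟩ := hex
    refine (ht.finite_zeros h₀ (by rw [hval _ h₀]; exact mul_ne_zero hne hσ)).subset ?_
    rintro z ⟨h, hz⟩
    exact ⟨h, by rw [hval _ h, hz, zero_mul]⟩
  refine (hX.biUnion hzeros).subset ?_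
  rintro z ⟨hz, hmult⟩
  by_contra hnot
  apply hmult
  have hinj : ∀ v ∈ W, f ⟨z, hz⟩ v = 0 → v = 0 := by
    intro v hv hv0
    by_contra hne
    have hbot : W ⊓ LinearMap.ker (f ⟨z, hz⟩) ≠ ⊥ :=
      (Submodule.ne_bot_iff _).2 ⟨v, ⟨hv, hv0⟩, hne⟩
    obtain ⟨x, ⟨hxW, hxK⟩, hx0, χ, hχ⟩ := exists_joint_eigenvector hf hbot fun i y hy => by
      refine ⟨hTW i y, ?_⟩
      have h1 := LinearMap.congr_fun (hf ⟨z, hz⟩ i).eq y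
      rw [End.mul_apply, End.mul_apply, LinearMap.mem_ker.1 hy.2, map_zero] at h1
      exact h1
    refine hnot (Set.mem_biUnion (x := χ) ⟨x, hxW, hx0, hχ⟩ ⟨hz, ?_⟩)
    have h2 := hχ ⟨z, hz⟩
    rw [LinearMap.mem_ker.1 hxK] at h2
    exact (smul_eq_zero.1 h2.symm).resolve_right hx0
  have hpow : ∀ k, ∀ v ∈ W, (f ⟨z, hz⟩ ^ k) v = 0 → v = 0 := by
    intro k
    induction k with
    | zero => intro v _ h; simpa using h
    | succ k ih =>
      intro v hv h
      rw [pow_succ, End.mul_apply] at h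
      exact hinj v hv (ih _ (hTW _ v) h)
  have hspan : (f ⟨z, hz⟩).maxGenEigenspace 0 = ℂ ∙ ψ := by
    apply le_antisymm
    · intro x hx
      obtain ⟨k, hk⟩ := End.mem_maxGenEigenspace _ _ _ |>.1 hx
      rw [zero_smul, sub_zero] at hk
      set a := (φ ⬝ᵥ x) / (φ ⬝ᵥ ψ) with ha
      have hy : x - a • ψ ∈ W := by
        rw [hW, dotProduct_sub, dotProduct_smul, smul_eq_mul, ha, div_mul_cancel₀ _ hover, sub_self]
      have h0 : x - a • ψ = 0 := by
        -- The extra power annihilates the multiple of ψ even when k = 0.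
        refine hpow (k + 1) _ hy ?_
        rw [map_sub, map_smul, pow_succ', End.mul_apply, hk, map_zero, ← pow_succ', pow_succ,
          End.mul_apply, hTψ, map_zero, smul_zero, sub_zero]
      rw [Submodule.mem_span_singleton]
      exact ⟨a, (sub_eq_zero.1 h0).symm⟩
    · rw [Submodule.span_singleton_le_iff_mem, End.mem_maxGenEigenspace]
      exact ⟨1, by simp [hTψ]⟩
  have hψ0 : ψ ≠ 0 := by
    rintro rfl
    exact hover (dotProduct_zero φ)
  rw [← Matrix.charpoly_toLin', ← LinearMap.finrank_maxGenEigenspace_eq]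
  exact (congrArg (fun U : Submodule ℂ (n → ℂ) => finrank ℂ U) hspan).trans
    (finrank_span_singleton hψ0)

end Commuting

/-! ### The overlap of the left and the right eigenvector -/

section Weights

variable {N : ℕ} {q : ℂ} {w : Fin N → ℂ}

variable (q w) in
/-- The components of the left eigenvector are products of these factors. -/
noncomputable def leftFactor (i : Fin N) (m : ℕ) : ℂ :=
  ∏ j, br (q ^ (1 - (m : ℤ)) * w i / w j) / br (q * w i / w j)

variable (q w) in
/-- The components of the right eigenvector are products of these factors. -/
noncomputable def rightFactor (i : Fin N) (m : ℕ) : ℂ :=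
  ∏ j, br (q ^ (2 * ((m : ℤ) - 1)) * w i / w j) / br (q ^ (-2 : ℤ) * w i / w j)

theorem br_zpow_ne_zero (hq : q ≠ 0) (hq4 : q ^ 4 ≠ 1) (hw : GenericInhom q w) {m : ℤ}
    (hm : |m| ≤ 2) (hm0 : m ≠ 0) (i j : Fin N) : br (q ^ m * w i / w j) ≠ 0 := by
  by_cases hij : i = j
  · subst hij
    rw [mul_div_assoc, div_self (hw.1 i), mul_one]
    have h1 := br_q_ne_zero hq hq4
    have h2 := br_q_sq_ne_zero hq hq4
    rw [abs_le] at hm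
    obtain ⟨hl, hr⟩ := hm
    interval_cases m
    · rw [show q ^ (-2 : ℤ) = (q ^ 2)⁻¹ by rw [zpow_neg]; rfl, br_inv]
      exact neg_ne_zero.2 h2
    · rw [zpow_neg_one, br_inv]
      exact neg_ne_zero.2 h1
    · exact absurd rfl hm0
    · rwa [zpow_one]
    · exact_mod_cast h2
  · exact hw.br_ne_zero hq hij hm

theorem br_q_ratio_ne_zero (hq : q ≠ 0) (hq4 : q ^ 4 ≠ 1) (hw : GenericInhom q w) (i j : Fin N) :
    br (q * w i / w j) ≠ 0 := by
  simpa using br_zpow_ne_zero hq hq4 hw (m := 1) (by norm_num) (by norm_num) i j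

theorem br_q_sq_inv_ratio_ne_zero (hq : q ≠ 0) (hq4 : q ^ 4 ≠ 1) (hw : GenericInhom q w)
    (i j : Fin N) : br (q ^ (-2 : ℤ) * w i / w j) ≠ 0 :=
  br_zpow_ne_zero hq hq4 hw (by norm_num) (by norm_num) i j

theorem leftFactor_zero (hq : q ≠ 0) (hq4 : q ^ 4 ≠ 1) (hw : GenericInhom q w) (i : Fin N) :
    leftFactor q w i 0 = 1 :=
  Finset.prod_eq_one fun j _ => by
    rw [Nat.cast_zero, sub_zero, zpow_one, div_self (br_q_ratio_ne_zero hq hq4 hw i j)]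

theorem leftFactor_one (hw : GenericInhom q w) (i : Fin N) : leftFactor q w i 1 = 0 :=
  Finset.prod_eq_zero (Finset.mem_univ i) <| by
    rw [Nat.cast_one, sub_self, zpow_zero, one_mul, div_self (hw.1 i), br_one, zero_div]

theorem leftFactor_two (i : Fin N) :
    leftFactor q w i 2 = ∏ j, br (q⁻¹ * w i / w j) / br (q * w i / w j) := by
  norm_num [leftFactor]

theorem rightFactor_zero (hq : q ≠ 0) (hq4 : q ^ 4 ≠ 1) (hw : GenericInhom q w) (i : Fin N) :
    rightFactor q w i 0 = 1 :=
  Finset.prod_eq_one fun j _ => by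
    rw [Nat.cast_zero, zero_sub, mul_neg, mul_one,
      div_self (br_q_sq_inv_ratio_ne_zero hq hq4 hw i j)]

theorem rightFactor_one (hw : GenericInhom q w) (i : Fin N) : rightFactor q w i 1 = 0 :=
  Finset.prod_eq_zero (Finset.mem_univ i) <| by
    rw [Nat.cast_one, sub_self, mul_zero, zpow_zero, one_mul, div_self (hw.1 i), br_one, zero_div]

theorem zpow_neg_two (q : ℂ) : q ^ (-2 : ℤ) = (q ^ 2)⁻¹ := by
  rw [zpow_neg]
  rfl

theorem rightFactor_two (i : Fin N) :
    rightFactor q w i 2 = ∏ j, br (q ^ 2 * w i / w j) / br ((q ^ 2)⁻¹ * w i / w j) := by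
  refine Finset.prod_congr rfl fun j _ => ?_
  rw [zpow_neg_two]
  norm_num

/-- This is the recursion `f2` of `HeightPair.exists_leftKernel`; the right factor satisfies the one
for the dual pair. -/
theorem aFun_mul_leftFactor (hq : q ≠ 0) (hq4 : q ^ 4 ≠ 1) (hw : GenericInhom q w) (i : Fin N) :
    aFun q w (w i) * leftFactor q w i 2 = dFun q w (q⁻¹ * (q * w i)) := by
  rw [leftFactor_two, aFun, dFun, ← Finset.prod_mul_distrib, inv_mul_cancel_left₀ hq]
  exact Finset.prod_congr rfl fun j _ => mul_div_cancel₀ _ (br_q_ratio_ne_zero hq hq4 hw i j)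

theorem dFun_mul_rightFactor (hq : q ≠ 0) (hq4 : q ^ 4 ≠ 1) (hw : GenericInhom q w) (i : Fin N) :
    dFun q w (q⁻¹ * w i) * rightFactor q w i 2 = aFun q w (q * w i) := by
  rw [rightFactor_two, aFun, dFun, ← Finset.prod_mul_distrib]
  refine Finset.prod_congr rfl fun j _ => ?_
  have h := br_q_sq_inv_ratio_ne_zero hq hq4 hw i j
  rw [zpow_neg_two] at h
  rw [← mul_assoc q⁻¹, ← mul_inv, ← sq, mul_div_cancel₀ _ h, ← mul_assoc, ← sq]

/-- The factor that a pair of sites with heights `2` and `0` contributes to the overlap. -/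
noncomputable def overlapFactor (q : ℂ) (x y : ℂ) : ℂ :=
  br (q⁻¹ * x / y) * br (q ^ 2 * x / y) / (br (q * x / y) * br (x / y))

/-- Pairs inside I cancel because the combined weight F satisfies F i j F j i = 1; on the cut pairs,
division by the norm removes the weight with q⁻². -/
theorem overlap_term (hq : q ≠ 0) (hq4 : q ^ 4 ≠ 1) (hw : GenericInhom q w)
    (I : Finset (Fin N)) :
    (∏ i, leftFactor q w i (natHeights (extremeHeights I) i)) *
        (∏ i, rightFactor q w i (natHeights (extremeHeights I) i)) /
      cutProd (fun i k => br (w i / w k) / br ((q ^ 2)⁻¹ * w i / w k)) I =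
      cutProd (fun i k => overlapFactor q (w i) (w k)) I := by
  have hq2 : ∀ i j, br ((q ^ 2)⁻¹ * w i / w j) ≠ 0 := fun i j => by
    have h := br_q_sq_inv_ratio_ne_zero hq hq4 hw i j
    rwa [zpow_neg_two] at h
  have hq1 := br_q_ratio_ne_zero hq hq4 hw
  set F : Fin N → Fin N → ℂ := fun i j => br (q⁻¹ * w i / w j) / br (q * w i / w j) *
    (br (q ^ 2 * w i / w j) / br ((q ^ 2)⁻¹ * w i / w j)) with hF
  have hFF : ∀ i j, F i j * F j i = 1 := fun i j => by
    have h1 := hq1 i j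
    have h2 := hq1 j i
    have h3 := hq2 i j
    have h4 := hq2 j i
    simp only [hF]
    rw [br_inv_div (q ^ 2)] at h3 h4
    rw [br_inv_div q, br_inv_div q, br_inv_div (q ^ 2), br_inv_div (q ^ 2)]
    rw [neg_ne_zero] at h3 h4
    field_simp
  have hF1 : ∀ i, F i i = 1 := fun i => by
    have h1 := hq1 i i
    have h3 := hq2 i i
    simp only [hF]
    rw [br_inv_div (q ^ 2)] at h3
    rw [br_inv_div q, br_inv_div (q ^ 2)]
    rw [neg_ne_zero] at h3
    field_simp
  have hprod : (∏ i, leftFactor q w i (natHeights (extremeHeights I) i)) *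
      (∏ i, rightFactor q w i (natHeights (extremeHeights I) i)) = cutProd F I := by
    rw [← prod_prod_eq_cutProd F I (fun i j _ _ => hFF i j) fun i _ => hF1 i,
      ← Finset.prod_mul_distrib]
    have : ∀ i, leftFactor q w i (natHeights (extremeHeights I) i) *
        rightFactor q w i (natHeights (extremeHeights I) i) =
          if i ∈ I then ∏ j, F i j else 1 := fun i => by
      rw [natHeights_extreme]
      by_cases hi : i ∈ I
      · rw [if_pos hi, if_pos hi, leftFactor_two, rightFactor_two, ← Finset.prod_mul_distrib]
      · rw [if_neg hi, if_neg hi, leftFactor_zero hq hq4 hw, rightFactor_zero hq hq4 hw, one_mul]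
    rw [Finset.prod_congr rfl fun i _ => this i, Finset.prod_ite_mem, Finset.univ_inter]
  rw [hprod, cutProd, cutProd, cutProd, ← Finset.prod_div_distrib]
  refine Finset.prod_congr rfl fun i hi => ?_
  rw [← Finset.prod_div_distrib]
  refine Finset.prod_congr rfl fun k hk => ?_
  have hik : i ≠ k := fun e => Finset.mem_compl.1 hk (e ▸ hi)
  have h1 := hq1 i k
  have h2 := hq2 i k
  have h3 := hw.br_div_ne hq hik
  simp only [hF, overlapFactor]
  generalize br (q⁻¹ * w i / w k) = a at *
  generalize br (q * w i / w k) = b at *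
  generalize br (q ^ 2 * w i / w k) = c at *
  generalize br ((q ^ 2)⁻¹ * w i / w k) = d at *
  generalize br (w i / w k) = e at *
  field_simp

/-- Both null vectors have zero component as soon as some height is 1, so only heights 0 and 2, that
is subsets of sites, remain. -/
theorem HeightPair.dotProduct_eq_sum_cutProd {n : Type*} [Fintype n] [DecidableEq n]
    {A B C D : ℂ → Matrix n n ℂ} {c e : ℂ → ℂ} {K L : (Fin N → ℕ) → n → ℂ}
    (S : HeightPair q w A B C D c e K L) (hn : Fintype.card n = 3 ^ N) {x y : n → ℂ}
    (hx : ∀ h : Fin N → ℕ, (∀ i, h i ≤ 2) → x ⬝ᵥ K h = ∏ i, leftFactor q w i (h i))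
    (hy : ∀ h : Fin N → ℕ, (∀ i, h i ≤ 2) → y ⬝ᵥ L h = ∏ i, rightFactor q w i (h i)) :
    x ⬝ᵥ y = ∑ I : Finset (Fin N), cutProd (fun i k => overlapFactor q (w i) (w k)) I := by
  rw [S.dotProduct_eq_sum hn]
  symm
  refine Finset.sum_of_injOn extremeHeights ?_ (by simp) ?_ ?_
  · intro I _ J _ h
    ext i
    have := congrFun h i
    by_cases hi : i ∈ I <;> by_cases hj : i ∈ J <;> simp_all [extremeHeights]
  · intro h _ hh
    obtain ⟨i, hi⟩ : ∃ i, natHeights h i = 1 := by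
      by_contra hc
      push Not at hc
      refine hh ⟨Finset.univ.filter fun i => h i = 2, by simp, ?_⟩
      funext i
      have := hc i
      rw [natHeights] at this
      simp only [extremeHeights, Finset.mem_filter, Finset.mem_univ, true_and]
      generalize h i = m at this ⊢
      fin_cases m <;> simp_all
    rw [hx _ (natHeights_le h), Finset.prod_eq_zero (Finset.mem_univ i), zero_mul, zero_div]
    rw [hi, leftFactor_one S.hw]
  · intro I _
    rw [hx _ (natHeights_le _), dotProduct_comm (L _) y, hy _ (natHeights_le _), S.norm_extreme,
      overlap_term S.hq S.hq4 S.hw]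

end Weights

/-! ### The polynomial that controls the overlap -/

section Polynomial

/-- The numerator of `overlapFactor`. -/
def overlapNum {R : Type*} [CommRing R] (a x y : R) : R :=
  (x ^ 2 - a ^ 2 * y ^ 2) * (a ^ 4 * x ^ 2 - y ^ 2)

/-- The denominator of `overlapFactor`. -/
def overlapDen {R : Type*} [CommRing R] (a x y : R) : R :=
  a ^ 2 * (a ^ 2 * x ^ 2 - y ^ 2) * (x ^ 2 - y ^ 2)

theorem overlapFactor_eq {q x y : ℂ} (hq : q ≠ 0) (hx : x ≠ 0) (hy : y ≠ 0) :
    overlapFactor q x y = overlapNum q x y / overlapDen q x y := by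
  have e1 : br (q⁻¹ * x / y) = (x ^ 2 - q ^ 2 * y ^ 2) / (q * x * y) := by rw [br]; field_simp
  have e2 : br (q ^ 2 * x / y) = (q ^ 4 * x ^ 2 - y ^ 2) / (q ^ 2 * x * y) := by
    rw [br]; field_simp
  have e3 : br (q * x / y) = (q ^ 2 * x ^ 2 - y ^ 2) / (q * x * y) := by rw [br]; field_simp
  have e4 : br (x / y) = (x ^ 2 - y ^ 2) / (x * y) := by rw [br]; field_simp
  rw [overlapFactor, e1, e2, e3, e4, overlapNum, overlapDen]
  field_simp

/-- The overlap of the two eigenvectors, multiplied by the common denominator of its terms. -/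
noncomputable def overlapPoly (N : ℕ) (q : ℂ) : MvPolynomial (Fin N) ℂ :=
  ∑ I : Finset (Fin N), ∏ p ∈ (Finset.univ : Finset (Fin N)).offDiag,
    if p.1 ∈ I ∧ p.2 ∉ I then
      overlapNum (MvPolynomial.C q) (MvPolynomial.X p.1) (MvPolynomial.X p.2)
    else overlapDen (MvPolynomial.C q) (MvPolynomial.X p.1) (MvPolynomial.X p.2)

theorem eval_overlapPoly {N : ℕ} {q : ℂ} {w : Fin N → ℂ} (hq : q ≠ 0) (hw : ∀ i, w i ≠ 0)
    (hd : ∀ i k, i ≠ k → overlapDen q (w i) (w k) ≠ 0) :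
    MvPolynomial.eval w (overlapPoly N q) =
      (∏ p ∈ (Finset.univ : Finset (Fin N)).offDiag, overlapDen q (w p.1) (w p.2)) *
        ∑ I : Finset (Fin N), cutProd (fun i k => overlapFactor q (w i) (w k)) I := by
  rw [overlapPoly, map_sum, Finset.mul_sum]
  refine Finset.sum_congr rfl fun I _ => ?_
  rw [map_prod, cutProd_eq_prod_offDiag, ← Finset.prod_mul_distrib]
  refine Finset.prod_congr rfl fun p hp => ?_
  have hne := hd _ _ (Finset.mem_offDiag.1 hp).2.2
  by_cases h : p.1 ∈ I ∧ p.2 ∉ I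
  · rw [if_pos h, if_pos h, overlapFactor_eq hq (hw _) (hw _), mul_div_cancel₀ _ hne]
    simp [overlapNum]
  · rw [if_neg h, if_neg h, mul_one]
    simp [overlapDen]

open Filter Topology in
-- The factor is a rational function of x²/y² that equals 1 both at 0 and at infinity.
theorem tendsto_overlapFactor {q : ℂ} (hq : q ≠ 0) {i k : ℕ} (hik : i ≠ k) :
    Tendsto (fun t : ℂ => overlapFactor q (t ^ i) (t ^ k)) (𝓝[≠] 0) (𝓝 1) := by
  rcases lt_or_gt_of_ne hik with h | h
  · obtain ⟨m, rfl⟩ := Nat.exists_eq_add_of_lt h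
    have hc : ContinuousAt (fun t : ℂ => (1 - q ^ 2 * (t ^ (m + 1)) ^ 2) *
        (q ^ 4 - (t ^ (m + 1)) ^ 2) /
          (q ^ 2 * (q ^ 2 - (t ^ (m + 1)) ^ 2) * (1 - (t ^ (m + 1)) ^ 2))) 0 := by
      refine ContinuousAt.div (by fun_prop) (by fun_prop) ?_
      simp [hq]
    have hl := hc.tendsto.mono_left (nhdsWithin_le_nhds (s := {0}ᶜ))
    have h1 : (1 - q ^ 2 * ((0 : ℂ) ^ (m + 1)) ^ 2) * (q ^ 4 - (0 ^ (m + 1)) ^ 2) /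
          (q ^ 2 * (q ^ 2 - (0 ^ (m + 1)) ^ 2) * (1 - (0 ^ (m + 1)) ^ 2)) = 1 := by
      simp
      field_simp
    rw [h1] at hl
    refine hl.congr' ?_
    filter_upwards [self_mem_nhdsWithin] with t ht
    have ht0 : t ≠ 0 := ht
    rw [overlapFactor_eq hq (pow_ne_zero _ ht0) (pow_ne_zero _ ht0),
      ← mul_div_mul_left _ _ (pow_ne_zero (4 * i) ht0), overlapNum, overlapDen]
    congr 1 <;> ring
  · obtain ⟨m, rfl⟩ := Nat.exists_eq_add_of_lt h
    have hc : ContinuousAt (fun t : ℂ => ((t ^ (m + 1)) ^ 2 - q ^ 2) *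
        (q ^ 4 * (t ^ (m + 1)) ^ 2 - 1) /
          (q ^ 2 * (q ^ 2 * (t ^ (m + 1)) ^ 2 - 1) * ((t ^ (m + 1)) ^ 2 - 1))) 0 := by
      refine ContinuousAt.div (by fun_prop) (by fun_prop) ?_
      simp [hq]
    have hl := hc.tendsto.mono_left (nhdsWithin_le_nhds (s := {0}ᶜ))
    have h1 : (((0 : ℂ) ^ (m + 1)) ^ 2 - q ^ 2) * (q ^ 4 * (0 ^ (m + 1)) ^ 2 - 1) /
          (q ^ 2 * (q ^ 2 * (0 ^ (m + 1)) ^ 2 - 1) * ((0 ^ (m + 1)) ^ 2 - 1)) = 1 := by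
      simp [hq]
    rw [h1] at hl
    refine hl.congr' ?_
    filter_upwards [self_mem_nhdsWithin] with t ht
    have ht0 : t ≠ 0 := ht
    rw [overlapFactor_eq hq (pow_ne_zero _ ht0) (pow_ne_zero _ ht0),
      ← mul_div_mul_left _ _ (pow_ne_zero (4 * k) ht0), overlapNum, overlapDen]
    congr 1 <;> ring

open Filter Topology in
theorem overlapPoly_ne_zero (N : ℕ) {q : ℂ} (hq : q ≠ 0) : overlapPoly N q ≠ 0 := by
  have hik : ∀ i k : Fin N, i ≠ k →
      Tendsto (fun t : ℂ => overlapFactor q (t ^ (i : ℕ)) (t ^ (k : ℕ))) (𝓝[≠] 0) (𝓝 1) :=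
    fun i k h => tendsto_overlapFactor hq fun e => h (Fin.ext e)
  have hsum : Tendsto (fun t : ℂ => ∑ I : Finset (Fin N),
      cutProd (fun i k : Fin N => overlapFactor q (t ^ (i : ℕ)) (t ^ (k : ℕ))) I) (𝓝[≠] 0)
      (𝓝 (∑ I : Finset (Fin N), cutProd (fun _ _ => 1) I)) :=
    tendsto_finsetSum _ fun I _ => tendsto_finsetProd _ fun i hi =>
      tendsto_finsetProd _ fun k hk => hik i k fun e => Finset.mem_compl.1 hk (e ▸ hi)
  have hlim : ∑ I : Finset (Fin N), cutProd (fun _ _ => 1) I ≠ 0 := by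
    simp [cutProd]
  have hev1 := hsum.eventually_ne hlim
  have hev2 : ∀ᶠ t : ℂ in 𝓝[≠] 0, ∀ i k : Fin N, i ≠ k →
      overlapFactor q (t ^ (i : ℕ)) (t ^ (k : ℕ)) ≠ 0 := by
    rw [eventually_all]; intro i
    rw [eventually_all]; intro k
    by_cases h : i = k
    · simp [h]
    · filter_upwards [(hik i k h).eventually_ne one_ne_zero] with t ht _ using ht
  obtain ⟨t, h1, h2, ht⟩ := (hev1.and (hev2.and self_mem_nhdsWithin)).exists
  have ht0 : t ≠ 0 := ht
  have hw : ∀ i : Fin N, t ^ (i : ℕ) ≠ 0 := fun i => pow_ne_zero _ ht0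
  -- Division by zero gives zero, so a non-zero factor certifies a non-zero denominator.
  have hd : ∀ i k : Fin N, i ≠ k → overlapDen q (t ^ (i : ℕ)) (t ^ (k : ℕ)) ≠ 0 :=
    fun i k h h0 => h2 i k h (by rw [overlapFactor_eq hq (hw i) (hw k), h0, div_zero])
  intro h0
  have := eval_overlapPoly hq hw hd
  rw [h0, map_zero, eq_comm, mul_eq_zero, Finset.prod_eq_zero_iff] at this
  rcases this with ⟨p, hp, h3⟩ | h3
  · exact hd _ _ (Finset.mem_offDiag.1 hp).2.2 h3
  · exact h1 h3

theorem GenericInhom.overlapDen_ne_zero {N : ℕ} {q : ℂ} {w : Fin N → ℂ} (hq : q ≠ 0)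
    (hw : GenericInhom q w) {i k : Fin N} (hik : i ≠ k) : overlapDen q (w i) (w k) ≠ 0 := by
  refine mul_ne_zero (mul_ne_zero (pow_ne_zero _ hq) ?_) ?_
  · have := hw.2 k i hik.symm 1 (by norm_num)
    rw [sub_ne_zero]
    exact fun h => this (by exact_mod_cast h.symm)
  · have := hw.2 i k hik 0 (by norm_num)
    rw [sub_ne_zero]
    simpa using this

end Polynomial

/-! ### Commuting transfer matrices and their null vectors -/

section Transfer

variable {N : ℕ} {q s : ℂ} {w : Fin N → ℂ}

theorem IsTrig.apply_neg {n : ℕ} {f : ℂ → ℂ} (hf : IsTrig n f) {z : ℂ} (hz : z ≠ 0) :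
    f (-z) = (-1) ^ (n + 1) * f z := by
  obtain ⟨p, -, hp⟩ := hf
  have h1 := hp z hz
  have h2 := hp (-z) (neg_ne_zero.2 hz)
  rw [neg_sq, neg_mul, ← h1, neg_pow] at h2
  apply mul_left_cancel₀ (pow_ne_zero n hz)
  have h3 : ((-1 : ℂ) ^ n) * (-1) ^ n = 1 := by rw [← mul_pow]; simp
  linear_combination (-1) ^ n * h2 - z ^ n * f (-z) * h3

theorem isTrig_transferAD (σ τ : Conf N) : IsTrig N fun z => transferAD q s w z σ τ := by
  have hB := isTrig_opB (q := q) (s := s) (w := w) σ τ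
  have hC := isTrig_opC (q := q) (s := s) (w := w) σ τ
  refine ((hB.add hC).const_mul Complex.I).congr fun z _ => ?_
  rw [transferAD_eq, Matrix.smul_apply, Matrix.add_apply, smul_eq_mul]

theorem transferAD_neg {z : ℂ} (hz : z ≠ 0) :
    transferAD q s w (-z) = ((-1 : ℂ) ^ (N + 1)) • transferAD q s w z := by
  ext σ τ
  exact (isTrig_transferAD σ τ).apply_neg hz

/-- The transfer matrices commute. -/
theorem transferAD_commute (hq : q ≠ 0) (hq4 : q ^ 4 ≠ 1) (hs : s ^ 2 = br q * br (q ^ 2))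
    (hw : ∀ i, w i ≠ 0) {u v : ℂ} (hu : u ≠ 0) (hv : v ≠ 0) :
    Commute (transferAD q s w u) (transferAD q s w v) := by
  -- If u² = v², then [u/v] = 0 and the exchange relation is void; parity of the transfer matrix
  -- takes its place.
  by_cases h : u ^ 2 = v ^ 2
  · rcases sq_eq_sq_iff_eq_or_eq_neg.1 h with rfl | rfl
    · exact Commute.refl _
    · rw [transferAD_neg hv]
      exact (Commute.refl _).smul_left _
  · have hne := br_div_ne_zero hu hv h
    have h1 : br (u / v) • (opC q s w u * opB q s w v - opB q s w v * opC q s w u) = _ :=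
      (monodromyBlocks_exchange hq hs hw hu hv).CB
    have h2 : br (v / u) • (opC q s w v * opB q s w u - opB q s w u * opC q s w v) = _ :=
      (monodromyBlocks_exchange hq hs hw hv hu).CB
    rw [← inv_div, br_inv, neg_smul, neg_eq_iff_eq_neg] at h2
    -- Exchanging u and v changes the sign of both sides, so the two commutators of C with B
    -- coincide.
    have h3 : br (u / v) • ((opC q s w u * opB q s w v - opB q s w v * opC q s w u) -
        (opC q s w v * opB q s w u - opB q s w u * opC q s w v)) = 0 := by
      rw [smul_sub, h1, h2, ← smul_neg, ← smul_sub, neg_sub, sub_self, smul_zero]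
    have h4 := (smul_eq_zero.1 h3).resolve_left hne
    have hB := (opB_commute hq hq4 hs hw hu hv).eq
    have hC := (opC_commute hq hq4 hs hw hu hv).eq
    rw [transferAD_eq, transferAD_eq]
    refine Commute.smul_left (Commute.smul_right ?_ _) _
    rw [Commute, SemiconjBy, ← sub_eq_zero, ← h4, mul_add, add_mul, add_mul, mul_add, add_mul,
      add_mul, hB, hC]
    abel

theorem card_conf (N : ℕ) : Fintype.card (Conf N) = 3 ^ N := by simp

/-- The left eigenvector of the transfer matrix with eigenvalue zero. -/
theorem exists_leftEigenvector (hq : q ≠ 0) (hq4 : q ^ 4 ≠ 1) (hs : s ^ 2 = br q * br (q ^ 2))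
    (hw : GenericInhom q w) :
    ∃ ψ : Conf N → ℂ, ψ ≠ 0 ∧
      (∀ φ : Conf N → ℂ, (∀ z, z ≠ 0 → φ ᵥ* transferAD q s w z = 0) ↔ ∃ c : ℂ, φ = c • ψ) ∧
      ∀ h : Fin N → ℕ, (∀ i, h i ≤ 2) →
        ψ ⬝ᵥ ketState q s w h = ∏ i, leftFactor q w i (h i) := by
  obtain ⟨ψ, h0, h1, h2⟩ := (heightPair hq hq4 hs hw).exists_leftKernel (card_conf N)
    (leftFactor_zero hq hq4 hw) (leftFactor_one hw) (aFun_mul_leftFactor hq hq4 hw)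
  refine ⟨ψ, h0, fun φ => ?_, h2⟩
  rw [← h1]
  simp only [transferAD_eq, Matrix.vecMul_smul, smul_eq_zero, Complex.I_ne_zero, false_or]

/-- The right eigenvector of the transfer matrix with eigenvalue zero. -/
theorem exists_rightEigenvector (hq : q ≠ 0) (hq4 : q ^ 4 ≠ 1) (hs : s ^ 2 = br q * br (q ^ 2))
    (hw : GenericInhom q w) :
    ∃ ψ : Conf N → ℂ, ψ ≠ 0 ∧
      (∀ v : Conf N → ℂ, (∀ z, z ≠ 0 → transferAD q s w z *ᵥ v = 0) ↔ ∃ c : ℂ, v = c • ψ) ∧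
      ∀ h : Fin N → ℕ, (∀ i, h i ≤ 2) →
        ψ ⬝ᵥ braState q s w h = ∏ i, rightFactor q w i (h i) := by
  obtain ⟨ψ, h0, h1, h2⟩ := (heightPair hq hq4 hs hw).dual.exists_leftKernel (card_conf N)
    (rightFactor_zero hq hq4 hw) (rightFactor_one hw) (dFun_mul_rightFactor hq hq4 hw)
  refine ⟨ψ, h0, fun φ => ?_, h2⟩
  rw [← h1]
  simp only [transferAD_eq, Matrix.smul_mulVec, smul_eq_zero, Complex.I_ne_zero, false_or,
    ← Matrix.transpose_add, Matrix.vecMul_transpose, add_comm (opC _ _ _ _)]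

end Transfer

end TenVertex

theorem mainTheorem9 (N : ℕ) (q s : ℂ) (hq0 : q ≠ 0) (hq4 : q ^ 4 ≠ 1)
    (hs : s ^ 2 = TenVertex.br q * TenVertex.br (q ^ 2)) :
    (∀ w : Fin N → ℂ, TenVertex.GenericInhom q w →
      -- the height states and the dual height states are bases
      LinearIndependent ℂ (TenVertex.heightKet q s w) ∧
      Submodule.span ℂ (Set.range (TenVertex.heightKet q s w)) = ⊤ ∧
      LinearIndependent ℂ (TenVertex.heightBra q s w) ∧
      Submodule.span ℂ (Set.range (TenVertex.heightBra q s w)) = ⊤ ∧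
      -- the left eigenvector
      (∃ ψL : TenVertex.Conf N → ℂ, ψL ≠ 0 ∧
        (∀ φ : TenVertex.Conf N → ℂ,
          (∀ z : ℂ, z ≠ 0 → φ ᵥ* TenVertex.transferAD q s w z = 0) ↔ ∃ c : ℂ, φ = c • ψL) ∧
        ∀ h : Fin N → Fin 3,
          ψL ⬝ᵥ TenVertex.heightKet q s w h =
            ∏ i, ∏ j, TenVertex.br (q ^ (1 - ((h i : ℕ) : ℤ)) * w i / w j) /
              TenVertex.br (q * w i / w j)) ∧
      -- the right eigenvector
      (∃ ψR : TenVertex.Conf N → ℂ, ψR ≠ 0 ∧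
        (∀ v : TenVertex.Conf N → ℂ,
          (∀ z : ℂ, z ≠ 0 → TenVertex.transferAD q s w z *ᵥ v = 0) ↔ ∃ c : ℂ, v = c • ψR) ∧
        ∀ h : Fin N → Fin 3,
          TenVertex.heightBra q s w h ⬝ᵥ ψR =
            ∏ i, ∏ j, TenVertex.br (q ^ (2 * (((h i : ℕ) : ℤ) - 1)) * w i / w j) /
              TenVertex.br (q ^ (-2 : ℤ) * w i / w j))) ∧
    -- the eigenvalue 0 of the single matrices is simple
    (∃ P : MvPolynomial (Fin N) ℂ, P ≠ 0 ∧
      ∀ w : Fin N → ℂ, TenVertex.GenericInhom q w → MvPolynomial.eval w P ≠ 0 →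
        {z : ℂ | z ≠ 0 ∧
          (TenVertex.transferAD q s w z).charpoly.rootMultiplicity 0 ≠ 1}.Finite) := by
  refine ⟨fun w hw => ?_, TenVertex.overlapPoly N q, TenVertex.overlapPoly_ne_zero N hq0,
    fun w hw hP => ?_⟩
  · have S := TenVertex.heightPair hq0 hq4 hs hw
    have hn := TenVertex.card_conf N
    obtain ⟨ψL, hL0, hL, hLK⟩ := TenVertex.exists_leftEigenvector hq0 hq4 hs hw
    obtain ⟨ψR, hR0, hR, hRL⟩ := TenVertex.exists_rightEigenvector hq0 hq4 hs hw
    -- The kets play the role of `L` in the dual pair; the restriction of `ketState` and `braState`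
    -- to heights at most 2 is definitionally the pair of families in the statement.
    refine ⟨S.dual.linearIndependent_L, S.dual.span_L hn, S.linearIndependent_L, S.span_L hn,
      ⟨ψL, hL0, hL, fun h => hLK _ (TenVertex.natHeights_le h)⟩, ψR, hR0, hR, fun h => ?_⟩
    rw [dotProduct_comm]
    exact hRL _ (TenVertex.natHeights_le h)
  · obtain ⟨ψL, -, hL, hLK⟩ := TenVertex.exists_leftEigenvector hq0 hq4 hs hw
    obtain ⟨ψR, -, hR, hRL⟩ := TenVertex.exists_rightEigenvector hq0 hq4 hs hw
    refine TenVertex.finite_rootMultiplicity_ne_one TenVertex.isTrig_transferAD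
      (fun u v hu hv => TenVertex.transferAD_commute hq0 hq4 hs hw.1 hu hv)
      ((hL ψL).2 ⟨1, (one_smul _ _).symm⟩) hR ?_
    rw [(TenVertex.heightPair hq0 hq4 hs hw).dotProduct_eq_sum_cutProd (TenVertex.card_conf N)
      hLK hRL]
    rw [TenVertex.eval_overlapPoly hq0 hw.1 fun i k hik => hw.overlapDen_ne_zero hq0 hik] at hP
    exact right_ne_zero_of_mul hP
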